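/- **Quartic Jacobi symbol.** For a prime $\pi$ of $\mathbb Z[i]$ of odd norm $N(\pi)$ and $\alpha\in\mathbb Z[i]$ put $\left(\frac{\alpha}{\pi}\right)_4=0$ if $\pi\mid\alpha$; otherwise $\left(\frac{\alpha}{\pi}\right)_4$ is the unique element of $\{1,i,-1,-i\}$ with $\alpha^{(N(\pi)-1)/4}\equiv\left(\frac{\alpha}{\pi}\right)_4 \pmod{\pi}$. For $\gamma\in\mathbb Z[i]$ of odd norm with prime factorization $\gamma=u\,\pi_1\cdots\pi_s$ ($u$ a unit) put $\left(\frac{\alpha}{\gamma}\right)_4=\prod_{j=1}^s\left(\frac{\alpha}{\pi_j}\right)_4$ (equal to $1$ if $\gamma$ is a unit). For a rational number $t=m/n$ in lowest terms with $n$ coprime to $\gamma$ put $\left(\frac{t+i}{\gamma}\right)_4=\left(\frac{m+ni}{\gamma}\right)_4\left(\frac{n}{\gamma}\right)_4^{-1}$. **Theorem.** Let $p\equiv 1\pmod 8$ be a prime and let $q\in\mathbb Z$ be odd (of either sign) with $p\nmid q$. Suppose $p=c^2+d^2=x^2+2qy^2$ with $c,d,x,y\in\mathbb Z$, $c\equiv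 1\pmod 4$, $d=2^rd_0$ with $r\ge 0$ an integer, $d_0\equiv 1\pmod 4$, and $\gcd(c,x+d)=1$. Let $k\in\mathbb Z$ and assume that $$\left(\frac{\frac{c}{x+d}+i}{q}\right)_4=i^k .$$ Then $$(-q)^{\frac{p-1}8}\equiv\begin{cases} (-1)^{\frac{q-1}8+\frac d4+\frac y2}\left(\frac dc\right)^{k}\pmod p&\text{if } q\equiv 1\pmod 8,\\[2pt] (-1)^{\frac{q-3}8+\frac{x-1}2}\left(\frac dc\right)^{k+1}\pmod p&\text{if } q\equiv 3\pmod 8,\\[2pt] (-1)^{\frac{q-5}8+\frac d4+\frac{x-1}2+\frac y2}\left(\frac dc\right)^{k-1}\pmod p&\text{if } q\equiv 5\pmod 8,\\[2pt] (-1)^{\frac{q+1}8}\left(\frac dc\right)^{k}\pmod p&\text{if } q\equiv 7\pmod 8. \end{cases}$$ Here $\frac dc$ is the quotient of $d$ by $c$ modulo $p$; the hypotheses imply $4\mid d$, $2\mid y$, $2\nmid x$ and $p\nmid cd$, so all exponents are integers. -/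

import Mathlib

noncomputable section

namespace QuarticJacobi

open Classical in
/-- The quartic residue symbol of a Gaussian integer `α` at a Gaussian prime `π` of odd norm `N`:
it is `0` if `π ∣ α`, and otherwise the unique power `i ^ r` with
`α ^ ((N - 1) / 4) ≡ i ^ r` modulo `π`. -/
def primeSymbol (α π : GaussianInt) : ℂ :=
  if π ∣ α then 0
  else if π ∣ α ^ (((Zsqrtd.norm π).natAbs - 1) / 4) - 1 then 1
  else if π ∣ α ^ (((Zsqrtd.norm π).natAbs - 1) / 4) - ⟨0, 1⟩ then Complex.I
  else if π ∣ α ^ (((Zsqrtd.norm π).natAbs - 1) / 4) - (-1) then -1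
  else if π ∣ α ^ (((Zsqrtd.norm π).natAbs - 1) / 4) - ⟨0, -1⟩ then -Complex.I
  else 0

/-- The quartic Jacobi symbol of `α` modulo a Gaussian integer `γ` of odd norm: the product of the
quartic residue symbols at the prime factors of `γ`, taken with multiplicity. The prime symbol
does not change if the prime is multiplied by a unit, so the choice of the factors within their
classes of associates is immaterial. The symbol modulo a unit is `1`. -/
def symbol (α γ : GaussianInt) : ℂ :=
  ((UniqueFactorizationMonoid.factors γ).map (primeSymbol α)).prod

/-- The quartic Jacobi symbol of `t + i`, for a rational number `t`, modulo `γ`, by multiplicativity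
in the argument: for `t = m / n` in lowest terms, `t + i = (m + n i) / n`. It is meant for `n`
coprime to `γ`; otherwise its value is `0`. -/
def symbolAddI (t : ℚ) (γ : GaussianInt) : ℂ :=
  symbol ⟨t.num, (t.den : ℤ)⟩ γ / symbol ⟨(t.den : ℤ), 0⟩ γ

end QuarticJacobi

end

namespace QuarticJacobi

open GaussianInt UniqueFactorizationMonoid

/-! Put `π = c + di` and `γ = c + (x + d)i`, and write `(α/β)` for the quartic symbol. The two
representations of `p` give `N(γ) = 2(x(x + d) + qy²)`, so `γ = (1 + i)i^t g` with `N(g) = x(x + d)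
+ qy²`. For a rational `n ≡ 1 (mod 4)`, quartic reciprocity and the supplementary laws convert
`(γ/n)` into `(n/g)` times an explicit power of `i` (`symbol_of_eq_mul`). Now `γ` is the given
residue modulo `q`; `γ ≡ π` modulo `x`; `γ ≡ c` is rational modulo `x + d`, so that symbol is
trivial; and `γ² ≡ 2i(x + d)π` modulo `y`. On the other side `g ∣ N(g)` yields `qy² ≡ -x(x + d) (mod
g)`. Comparing exponents expresses `(x/π)(Y/π)⁻¹`, with `Y` the odd part of `y`, through `k`
(`exponent_relation`).

Raising `x² ≡ -2qy² (mod p)` to the power `(p - 1)/8` turns `(x/π)` and `(Y/π)` into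
`(-q)^((p-1)/8)`, up to powers of `2^((p-1)/8)`. The latter follows from `(c + d)² ≡ 2c²(d/c)` and
the symbols of `c` and `c + d` modulo `π`; here `d/c` is the image of `i` modulo `π` (`neg_pow_eq`).
What remains is arithmetic of exponents modulo 4.

Reciprocity comes from quartic Gauss sums: the fourth power of the sum attached to `π` is `π³ star
π`, and its `l`-th power is known from Frobenius in characteristic `l`. -/

/-! ### Symbol values and norms -/

/-- The Gaussian integers that occur as values of a quartic residue symbol. -/
def IsValue (z : GaussianInt) : Prop :=
  z = 0 ∨ z = 1 ∨ z = ⟨0, 1⟩ ∨ z = -1 ∨ z = ⟨0, -1⟩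

/-- The exponent `(N - 1) / 4` in the definition of the quartic residue symbol. -/
def symbolExponent (π : GaussianInt) : ℕ := (π.norm.natAbs - 1) / 4

lemma IsValue.mul {z w : GaussianInt} (hz : IsValue z) (hw : IsValue w) : IsValue (z * w) := by
  unfold IsValue at *
  rcases hz with rfl | rfl | rfl | rfl | rfl <;> rcases hw with rfl | rfl | rfl | rfl | rfl <;>
    decide

lemma IsValue.conj {z : GaussianInt} (hz : IsValue z) : IsValue (star z) := by
  unfold IsValue at *
  rcases hz with rfl | rfl | rfl | rfl | rfl <;> decide

lemma IsValue.one : IsValue 1 := .inr (.inl rfl)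

lemma IsValue.pow {z : GaussianInt} (hz : IsValue z) (n : ℕ) : IsValue (z ^ n) := by
  induction n with
  | zero => simpa using IsValue.one
  | succ n ih => rw [pow_succ]; exact ih.mul hz

lemma IsValue.mul_star {z : GaussianInt} (hz : IsValue z) (h0 : z ≠ 0) : z * star z = 1 := by
  rcases hz with rfl | rfl | rfl | rfl | rfl
  · exact absurd rfl h0
  all_goals decide

lemma IsValue.pow_four {z : GaussianInt} (hz : IsValue z) (h0 : z ≠ 0) : z ^ 4 = 1 := by
  rcases hz with rfl | rfl | rfl | rfl | rfl
  · exact absurd rfl h0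
  all_goals decide

lemma IsValue.sub_norm_dvd {z w : GaussianInt} (hz : IsValue z) (hw : IsValue w) (h : z ≠ w) :
    (z - w).norm ∣ 4 := by
  rcases hz with rfl | rfl | rfl | rfl | rfl <;> rcases hw with rfl | rfl | rfl | rfl | rfl <;>
    first
    | exact absurd rfl h
    | decide

lemma norm_dvd_norm {a b : GaussianInt} (h : a ∣ b) : a.norm ∣ b.norm := by
  obtain ⟨c, rfl⟩ := h
  exact ⟨c.norm, Zsqrtd.norm_mul _ _⟩

lemma isUnit_iff_norm {a : GaussianInt} : IsUnit a ↔ a.norm = 1 := by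
  rw [← Zsqrtd.norm_eq_one_iff, ← Int.natCast_inj, abs_natCast_norm]
  simp

lemma odd_norm_of_dvd {a b : GaussianInt} (h : a ∣ b) (hb : Odd b.norm) : Odd a.norm := by
  obtain ⟨c, rfl⟩ := h
  rw [Zsqrtd.norm_mul] at hb
  exact Int.Odd.of_mul_left hb

lemma ne_zero_of_odd_norm {a : GaussianInt} (h : Odd a.norm) : a ≠ 0 := by
  rintro rfl
  simp at h

lemma norm_mod_four {a : GaussianInt} (h : Odd a.norm) : a.norm % 4 = 1 := by
  obtain ⟨x, y⟩ := a
  have e : (⟨x, y⟩ : GaussianInt).norm = x * x + y * y := by simp [Zsqrtd.norm]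
  rw [e] at h ⊢
  rcases Int.even_or_odd' x with ⟨m, rfl | rfl⟩ <;> rcases Int.even_or_odd' y with ⟨n, rfl | rfl⟩
  · exact absurd h (by rw [Int.not_odd_iff_even]; exact ⟨2*m*m+2*n*n, by ring⟩)
  · ring_nf; omega
  · ring_nf; omega
  · exact absurd h (by rw [Int.not_odd_iff_even]; exact ⟨2*m*m+2*n*n+2*m+2*n+1, by ring⟩)

lemma four_mul_symbolExponent {a : GaussianInt} (h : Odd a.norm) :
    4 * symbolExponent a = a.norm.natAbs - 1 := by
  have h1 := norm_mod_four h
  have h2 := norm_nonneg a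
  unfold symbolExponent
  omega

lemma symbolExponent_pos {a : GaussianInt} (h : Odd a.norm) (hu : ¬ IsUnit a) :
    0 < symbolExponent a := by
  have h1 := norm_mod_four h
  have h2 := norm_nonneg a
  have h3 : a.norm ≠ 1 := fun h => hu (isUnit_iff_norm.2 h)
  unfold symbolExponent
  omega

/-- The norm of the difference of two distinct values divides 4, while an odd norm is 1 modulo 4,
hence can divide 4 only if it is 1. Congruences between values modulo an odd prime are therefore
equalities. -/
lemma IsValue.eq_of_dvd_sub {π z w : GaussianInt} (hz : IsValue z) (hw : IsValue w)
    (hu : ¬ IsUnit π) (ho : Odd π.norm) (h : π ∣ z - w) : z = w := by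
  by_contra hne
  have h1 : π.norm ∣ 4 := (norm_dvd_norm h).trans (hz.sub_norm_dvd hw hne)
  have h2 := norm_mod_four ho
  have h3 : π.norm ≤ 4 := Int.le_of_dvd (by norm_num) h1
  have h4 := norm_nonneg π
  have h5 : π.norm ≠ 1 := fun h => hu (isUnit_iff_norm.2 h)
  omega

/-! ### Residue fields and Frobenius in the Gaussian integers -/

/-- Reduction modulo a Gaussian integer of prime norm. -/
lemma exists_residue_hom {π : GaussianInt} {p : ℕ} [Fact p.Prime] (hN : π.norm = p) :
    ∃ f : GaussianInt →+* ZMod p, ∀ α, f α = 0 ↔ π ∣ α := by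
  obtain ⟨u, v⟩ := π
  have e : u * u + v * v = (p : ℤ) := by rw [← hN]; simp [Zsqrtd.norm]
  have e' : (u : ZMod p) * u + v * v = 0 := by
    have := congrArg (Int.cast : ℤ → ZMod p) e
    push_cast at this
    rw [this, CharP.cast_eq_zero]
  have hp : 1 < (p : ℤ) := by exact_mod_cast (Fact.out : p.Prime).one_lt
  -- If `p ∣ v` then also `p ∣ u`, and `p² ∣ u² + v² = p`.
  have hv : (v : ZMod p) ≠ 0 := by
    intro hv
    have hu : (u : ZMod p) = 0 := by simpa [hv] using e'
    rw [ZMod.intCast_zmod_eq_zero_iff_dvd] at hu hv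
    obtain ⟨a, rfl⟩ := hu
    obtain ⟨b, rfl⟩ := hv
    have : (p : ℤ) * (p * (a * a + b * b)) = p * 1 := by linear_combination e
    have := mul_left_cancel₀ (by omega) this
    have := Int.eq_one_of_mul_eq_one_right (by omega) this
    omega
  -- The image of `i` is forced by `u + vi ↦ 0`.
  let r : {r : ZMod p // r * r = ((-1 : ℤ) : ZMod p)} := ⟨-u / v, by
    push_cast
    field_simp
    linear_combination e'⟩
  refine ⟨Zsqrtd.lift r, fun α => ?_⟩
  have hf : ∀ β : GaussianInt, Zsqrtd.lift r β = β.re + β.im * (-u / v) := fun β => rfl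
  constructor
  · obtain ⟨a, b⟩ := α
    intro h
    rw [hf] at h
    simp only at h
    field_simp at h
    have h1 : ((a * u + b * v : ℤ) : ZMod p) = 0 := by
      have : (v : ZMod p) * (a * u + b * v) = 0 := by linear_combination u * h + b * e'
      push_cast
      exact (mul_eq_zero.1 this).resolve_left hv
    have h2 : ((b * u - a * v : ℤ) : ZMod p) = 0 := by
      push_cast; linear_combination -h
    rw [ZMod.intCast_zmod_eq_zero_iff_dvd] at h1 h2
    obtain ⟨m, hm⟩ := h1
    obtain ⟨n, hn⟩ := h2
    refine ⟨⟨m, n⟩, ?_⟩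
    have h0 : (p : ℤ) ≠ 0 := by omega
    ext
    · simp
      apply mul_left_cancel₀ h0
      linear_combination -a * e + u * hm - v * hn
    · simp
      apply mul_left_cancel₀ h0
      linear_combination -b * e + u * hn + v * hm
  · rintro ⟨β, rfl⟩
    rw [map_mul, hf]
    simp only
    field_simp
    simp

/-- A Gaussian prime divides a rational prime `p`, so its norm is `p` or `p²`; in the second case
the cofactor is a unit and `p` is inert. -/
lemma prime_cases {π : GaussianInt} (hπ : Prime π) (ho : Odd π.norm) :
    (∃ p : ℕ, p.Prime ∧ p % 4 = 3 ∧ Associated π p) ∨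
      (∃ p : ℕ, p.Prime ∧ p % 4 = 1 ∧ π.norm = p) := by
  obtain ⟨p, hp, hd⟩ : ∃ p : ℕ, p.Prime ∧ π ∣ (p : GaussianInt) := by
    have h : π ∣ ((π.norm.natAbs : ℕ) : GaussianInt) := by
      refine ⟨star π, ?_⟩
      rw [← Zsqrtd.norm_eq_mul_conj, ← Int.cast_natCast, abs_natCast_norm]
    have h1 : ((π.norm.natAbs : ℕ) : GaussianInt) =
        ((π.norm.natAbs.primeFactorsList.map (Nat.cast : ℕ → GaussianInt))).prod := by
      conv_lhs => rw [← Nat.prod_primeFactorsList (n := π.norm.natAbs) (by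
        simpa using ne_zero_of_odd_norm ho)]
      exact map_list_prod (Nat.castRingHom GaussianInt) _
    rw [h1, hπ.dvd_prod_iff] at h
    obtain ⟨a, ha, hd⟩ := h
    obtain ⟨p, hp, rfl⟩ := List.mem_map.1 ha
    exact ⟨p, Nat.prime_of_mem_primeFactorsList hp, hd⟩
  have : Fact p.Prime := ⟨hp⟩
  have hu : π.norm ≠ 1 := fun h => hπ.not_isUnit (isUnit_iff_norm.2 h)
  have hdn : π.norm.natAbs ∣ p ^ 2 := by
    have := norm_dvd_norm hd
    rw [Zsqrtd.norm_natCast, ← sq] at this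
    rw [← Int.natCast_dvd_natCast, abs_natCast_norm]
    exact_mod_cast this
  have hmod := norm_mod_four ho
  have hnn := abs_natCast_norm π
  obtain ⟨k, hk, hN⟩ := (Nat.dvd_prime_pow hp).1 hdn
  interval_cases k
  · rw [pow_zero] at hN
    omega
  · rw [pow_one] at hN
    right
    refine ⟨p, hp, by omega, by omega⟩
  · left
    obtain ⟨w, hw⟩ := hd
    have hwu : IsUnit w := by
      rw [isUnit_iff_norm]
      have := congrArg Zsqrtd.norm hw
      rw [Zsqrtd.norm_mul, Zsqrtd.norm_natCast, ← hnn, hN] at this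
      have h0 : (p : ℤ) ≠ 0 := by exact_mod_cast hp.ne_zero
      push_cast at this
      have h1 : (p : ℤ) ^ 2 * w.norm = p ^ 2 * 1 := by linear_combination -this
      exact mul_left_cancel₀ (pow_ne_zero 2 h0) h1
    have has : Associated π (p : GaussianInt) := ⟨hwu.unit, hw.symm⟩
    exact ⟨p, hp, (prime_iff_mod_four_eq_three_of_nat_prime p).1 (has.prime hπ), has⟩

lemma eq_add_mul_I (α : GaussianInt) : α = (α.re : GaussianInt) + α.im * ⟨0, 1⟩ := by
  ext <;> simp

lemma dvd_intCast_pow_sub {p : ℕ} (hp : p.Prime) (a : ℤ) :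
    (p : GaussianInt) ∣ (a : GaussianInt) ^ p - a := by
  have : Fact p.Prime := ⟨hp⟩
  have h : (p : ℤ) ∣ a ^ p - a := by
    rw [← ZMod.intCast_zmod_eq_zero_iff_dvd]
    push_cast
    rw [ZMod.pow_card, sub_self]
  have := (Int.castRingHom GaussianInt).map_dvd h
  simpa using this

lemma I_pow_of_mod_four {n : ℕ} (h : n % 4 = 3) : (⟨0, 1⟩ : GaussianInt) ^ n = ⟨0, -1⟩ := by
  conv_lhs => rw [← Nat.div_add_mod n 4, h]
  rw [pow_add, pow_mul, show (⟨0, 1⟩ : GaussianInt) ^ 4 = 1 by decide, one_pow]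
  decide

/-- Frobenius at a rational prime `p ≡ 3 (mod 4)` is complex conjugation. -/
lemma dvd_pow_sub_star {p : ℕ} (hp : p.Prime) (h3 : p % 4 = 3) (α : GaussianInt) :
    (p : GaussianInt) ∣ α ^ p - star α := by
  obtain ⟨r, hr⟩ := exists_add_pow_prime_eq hp (α.re : GaussianInt) (α.im * ⟨0, 1⟩)
  rw [← eq_add_mul_I, mul_pow, I_pow_of_mod_four h3] at hr
  have hs : star α = (α.re : GaussianInt) + α.im * ⟨0, -1⟩ := by ext <;> simp
  obtain ⟨m, hm⟩ := dvd_intCast_pow_sub hp α.re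
  obtain ⟨n, hn⟩ := dvd_intCast_pow_sub hp α.im
  rw [hs, hr]
  exact ⟨m + n * ⟨0, -1⟩ + α.re * (α.im * ⟨0, 1⟩) * r, by linear_combination hm + ⟨0, -1⟩ * hn⟩

/-- Fermat's little theorem in the Gaussian integers. -/
lemma dvd_pow_norm_sub {π : GaussianInt} (hπ : Prime π) (ho : Odd π.norm) (α : GaussianInt) :
    π ∣ α ^ π.norm.natAbs - α := by
  rcases prime_cases hπ ho with ⟨p, hp, h3, has⟩ | ⟨p, hp, -, hN⟩
  · have hN : π.norm.natAbs = p * p := by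
      obtain ⟨u, hu⟩ := has
      have := congrArg (fun z => z.norm.natAbs) hu
      simp only [Zsqrtd.norm_mul, Zsqrtd.norm_natCast, isUnit_iff_norm.1 u.isUnit, mul_one] at this
      rw [this, Int.natAbs_mul, Int.natAbs_natCast]
    rw [hN]
    refine has.dvd.trans ?_
    have h1 := dvd_pow_sub_star hp h3 α
    have h2 := dvd_pow_sub_star hp h3 (star α)
    rw [star_star] at h2
    have h4 : (p : GaussianInt) ∣ (α ^ p) ^ p - (star α) ^ p := h1.trans (sub_dvd_pow_sub_pow _ _ _)
    rw [pow_mul]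
    simpa using dvd_add h4 h2
  · have : Fact p.Prime := ⟨hp⟩
    obtain ⟨f, hf⟩ := exists_residue_hom hN
    rw [← hf, map_sub, map_pow, hN, Int.natAbs_natCast, ZMod.pow_card, sub_self]

/-! ### The quartic symbol at a prime -/

/-- With `N = 4e + 1`, the polynomial `α^N - α` splits as `α(α^e - 1)(α^e - i)(α^e + 1)(α^e + i)`,
and the prime divides one factor. Hence the final `else` branch of `primeSymbol` is never reached.
-/
lemma exists_value {π : GaussianInt} (hπ : Prime π) (ho : Odd π.norm) (α : GaussianInt) :
    ∃ z, IsValue z ∧ π ∣ α ^ symbolExponent π - z := by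
  have hpos := symbolExponent_pos ho hπ.not_isUnit
  by_cases hd : π ∣ α
  · exact ⟨0, .inl rfl, by simpa using hd.trans (dvd_pow_self _ hpos.ne')⟩
  have h := dvd_pow_norm_sub hπ ho α
  have h4 := four_mul_symbolExponent ho
  have : π.norm.natAbs = 4 * symbolExponent π + 1 := by
    have := norm_mod_four ho
    omega
  set e := symbolExponent π
  have hI : (⟨0, 1⟩ : GaussianInt) ^ 2 = -1 := by decide
  have hI' : (⟨0, -1⟩ : GaussianInt) = -⟨0, 1⟩ := by decide
  rw [this, show α ^ (4 * e + 1) - α = α * ((α ^ e - 1) * ((α ^ e - ⟨0, 1⟩) *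
    ((α ^ e - -1) * (α ^ e - ⟨0, -1⟩)))) by
      rw [hI']
      linear_combination (α * (α ^ e - 1) * (α ^ e - -1)) * hI] at h
  rcases (hπ.dvd_or_dvd h) with h | h
  · exact absurd h hd
  rcases (hπ.dvd_or_dvd h) with h | h
  · exact ⟨_, .inr (.inl rfl), h⟩
  rcases (hπ.dvd_or_dvd h) with h | h
  · exact ⟨_, .inr (.inr (.inl rfl)), h⟩
  rcases (hπ.dvd_or_dvd h) with h | h
  · exact ⟨_, .inr (.inr (.inr (.inl rfl))), h⟩
  · exact ⟨_, .inr (.inr (.inr (.inr rfl))), h⟩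

lemma primeSymbol_eq {π α z : GaussianInt} (hπ : Prime π) (ho : Odd π.norm) (hz : IsValue z)
    (h : π ∣ α ^ symbolExponent π - z) : primeSymbol α π = toComplex z := by
  have hpos := symbolExponent_pos ho hπ.not_isUnit
  have key : ∀ w, IsValue w → π ∣ α ^ symbolExponent π - w → z = w := fun w hw hd =>
    hz.eq_of_dvd_sub hw hπ.not_isUnit ho (by simpa using dvd_sub hd h)
  have hI : toComplex ⟨0, 1⟩ = Complex.I := by simp [toComplex_def']
  have hI' : toComplex ⟨0, -1⟩ = -Complex.I := by simp [toComplex_def']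
  unfold primeSymbol
  rw [← symbolExponent]
  split_ifs with h0 h1 h2 h3 h4
  · rw [key 0 (.inl rfl) (by simpa using h0.trans (dvd_pow_self _ hpos.ne')), map_zero]
  · rw [key _ (.inr (.inl rfl)) h1, map_one]
  · rw [key _ (.inr (.inr (.inl rfl))) h2, hI]
  · rw [key _ (.inr (.inr (.inr (.inl rfl)))) h3, map_neg, map_one]
  · rw [key _ (.inr (.inr (.inr (.inr rfl)))) h4, hI']
  · rcases hz with rfl | rfl | rfl | rfl | rfl
    · rw [map_zero]
    all_goals contradiction

lemma primeSymbol_mul_left {π : GaussianInt} (hπ : Prime π) (ho : Odd π.norm) (α β : GaussianInt) :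
    primeSymbol (α * β) π = primeSymbol α π * primeSymbol β π := by
  obtain ⟨z, hz, h⟩ := exists_value hπ ho α
  obtain ⟨w, hw, h'⟩ := exists_value hπ ho β
  rw [primeSymbol_eq hπ ho hz h, primeSymbol_eq hπ ho hw h', ← map_mul]
  refine primeSymbol_eq hπ ho (hz.mul hw) ?_
  obtain ⟨s, hs⟩ := h
  obtain ⟨t, ht⟩ := h'
  rw [mul_pow]
  exact ⟨s * β ^ symbolExponent π + z * t, by linear_combination β ^ symbolExponent π * hs + z * ht⟩

lemma primeSymbol_congr {π : GaussianInt} (hπ : Prime π) (ho : Odd π.norm) {α β : GaussianInt}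
    (h : π ∣ α - β) : primeSymbol α π = primeSymbol β π := by
  obtain ⟨z, hz, h'⟩ := exists_value hπ ho β
  rw [primeSymbol_eq hπ ho hz h']
  refine primeSymbol_eq hπ ho hz ?_
  simpa using dvd_add (h.trans (sub_dvd_pow_sub_pow α β (symbolExponent π))) h'

lemma star_dvd_star_iff {a b : GaussianInt} : star a ∣ star b ↔ a ∣ b := by
  constructor
  · rintro ⟨c, hc⟩
    exact ⟨star c, by rw [← star_star b, hc, star_mul', star_star]⟩
  · rintro ⟨c, rfl⟩
    exact ⟨star c, star_mul' _ _⟩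

lemma prime_star {π : GaussianInt} (hπ : Prime π) : Prime (star π) := by
  exact (MulEquiv.prime_iff (starRingAut (R := GaussianInt)).toMulEquiv (p := π)).2 hπ

lemma primeSymbol_star {π : GaussianInt} (hπ : Prime π) (ho : Odd π.norm) (α : GaussianInt) :
    primeSymbol (star α) (star π) = star (primeSymbol α π) := by
  obtain ⟨z, hz, h⟩ := exists_value hπ ho α
  have hN : (star π).norm = π.norm := Zsqrtd.norm_conj π
  rw [primeSymbol_eq hπ ho hz h, primeSymbol_eq (prime_star hπ) (by rwa [hN]) hz.conj]
  · rw [toComplex_star]; rfl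
  · rw [symbolExponent, hN, ← star_pow, ← star_sub, star_dvd_star_iff]
    exact h

lemma norm_eq_of_associated {a b : GaussianInt} (h : Associated a b) : a.norm = b.norm :=
  Int.dvd_antisymm (norm_nonneg _) (norm_nonneg _) (norm_dvd_norm h.dvd) (norm_dvd_norm h.symm.dvd)

lemma primeSymbol_associated {π ρ : GaussianInt} (h : Associated π ρ) (α : GaussianInt) :
    primeSymbol α π = primeSymbol α ρ := by
  have hd (c : GaussianInt) : π ∣ c ↔ ρ ∣ c := h.dvd_iff_dvd_left
  classical
  unfold primeSymbol
  rw [norm_eq_of_associated h]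
  exact if_congr (hd _) rfl (if_congr (hd _) rfl (if_congr (hd _) rfl
    (if_congr (hd _) rfl (if_congr (hd _) rfl rfl))))

/-! ### The quartic Jacobi symbol: multiplicativity and conjugation -/

lemma map_primeSymbol_eq_of_rel {s t : Multiset GaussianInt} (h : Multiset.Rel Associated s t)
    (α : GaussianInt) : s.map (primeSymbol α) = t.map (primeSymbol α) := by
  rw [← Multiset.rel_eq, Multiset.rel_map]
  exact h.mono fun a _ b _ hab => primeSymbol_associated hab α

lemma prime_of_mem_factors {γ π : GaussianInt} (h : π ∈ factors γ) : Prime π :=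
  prime_of_factor π h

lemma odd_norm_of_mem_factors {γ π : GaussianInt} (hγ : Odd γ.norm) (h : π ∈ factors γ) :
    Odd π.norm :=
  odd_norm_of_dvd (dvd_of_mem_factors h) hγ

lemma symbol_mul_left {γ : GaussianInt} (hγ : Odd γ.norm) (α β : GaussianInt) :
    symbol (α * β) γ = symbol α γ * symbol β γ := by
  unfold symbol
  rw [← Multiset.prod_map_mul]
  congr 1
  exact Multiset.map_congr rfl fun π hπ =>
    primeSymbol_mul_left (prime_of_mem_factors hπ) (odd_norm_of_mem_factors hγ hπ) _ _

lemma symbol_congr {γ : GaussianInt} (hγ : Odd γ.norm) {α β : GaussianInt} (h : γ ∣ α - β) :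
    symbol α γ = symbol β γ := by
  unfold symbol
  congr 1
  exact Multiset.map_congr rfl fun π hπ =>
    primeSymbol_congr (prime_of_mem_factors hπ) (odd_norm_of_mem_factors hγ hπ)
      ((dvd_of_mem_factors hπ).trans h)

lemma symbol_mul_right {γ δ : GaussianInt} (hγ : γ ≠ 0) (hδ : δ ≠ 0) (α : GaussianInt) :
    symbol α (γ * δ) = symbol α γ * symbol α δ := by
  unfold symbol
  rw [map_primeSymbol_eq_of_rel (factors_mul hγ hδ), Multiset.map_add, Multiset.prod_add]

lemma symbol_associated {γ δ : GaussianInt} (h : Associated γ δ) (α : GaussianInt) :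
    symbol α γ = symbol α δ := by
  unfold symbol
  rw [map_primeSymbol_eq_of_rel (factors_rel_of_associated h)]

lemma symbol_of_isUnit {γ : GaussianInt} (h : IsUnit γ) (α : GaussianInt) : symbol α γ = 1 := by
  simp [symbol, factors_of_isUnit h]

lemma symbol_prime {π : GaussianInt} (h : Prime π) (α : GaussianInt) :
    symbol α π = primeSymbol α π := by
  obtain ⟨ρ, hρ, hf⟩ := factors_eq_singleton_of_irreducible h.irreducible
  simp [symbol, hf, primeSymbol_associated hρ]

/-- Induction over the Gaussian integers of odd norm, one prime factor at a time. -/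
lemma induction_on_odd_norm {P : GaussianInt → Prop} (hu : ∀ u, IsUnit u → P u)
    (hmul : ∀ π γ, Prime π → Odd π.norm → Odd γ.norm → P π → P γ → P (π * γ))
    (hprime : ∀ π, Prime π → Odd π.norm → P π) {γ : GaussianInt} (hγ : Odd γ.norm) : P γ := by
  revert hγ
  refine induction_on_prime γ (fun h => absurd rfl (ne_zero_of_odd_norm h))
    (fun u h _ => hu u h) fun γ π _ hπ ih h => ?_
  rw [Zsqrtd.norm_mul, Int.odd_mul] at h
  exact hmul π γ hπ h.1 h.2 (hprime π hπ h.1) (ih h.2)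

lemma symbol_star {γ : GaussianInt} (hγ : Odd γ.norm) (α : GaussianInt) :
    symbol (star α) (star γ) = star (symbol α γ) := by
  refine induction_on_odd_norm (P := fun γ => symbol (star α) (star γ) = star (symbol α γ))
    (fun u h => ?_) (fun π γ hπ ho hγ h1 h2 => ?_) (fun π hπ ho => ?_) hγ
  · rw [symbol_of_isUnit h, symbol_of_isUnit (by
      rw [isUnit_iff_norm] at h ⊢; rwa [Zsqrtd.norm_conj]), star_one]
  · have h1' := ne_zero_of_odd_norm ho
    have h2' := ne_zero_of_odd_norm hγ
    rw [star_mul', symbol_mul_right (by simpa using h1') (by simpa using h2'), h1, h2,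
      symbol_mul_right h1' h2', star_mul']
  · rw [symbol_prime hπ, symbol_prime (prime_star hπ), primeSymbol_star hπ ho]

/-- The symbol is zero or a power of `I`. -/
lemma exists_symbol_eq {γ : GaussianInt} (hγ : Odd γ.norm) (α : GaussianInt) :
    ∃ z, IsValue z ∧ symbol α γ = toComplex z := by
  refine induction_on_odd_norm (P := fun γ => ∃ z, IsValue z ∧ symbol α γ = toComplex z)
    (fun u h => ⟨1, .one, by rw [symbol_of_isUnit h, map_one]⟩) ?_ (fun π hπ ho => ?_) hγ
  · rintro π γ hπ ho hγ ⟨z, hz, h⟩ ⟨w, hw, h'⟩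
    exact ⟨z * w, hz.mul hw, by
      rw [symbol_mul_right (ne_zero_of_odd_norm ho) (ne_zero_of_odd_norm hγ), h, h', map_mul]⟩
  · obtain ⟨z, hz, h⟩ := exists_value hπ ho α
    exact ⟨z, hz, by rw [symbol_prime hπ, primeSymbol_eq hπ ho hz h]⟩

lemma symbol_ne_zero {γ : GaussianInt} (hγ : Odd γ.norm) {α : GaussianInt}
    (h : IsCoprime α γ) : symbol α γ ≠ 0 := by
  unfold symbol
  intro h0
  rw [Multiset.prod_eq_zero_iff] at h0
  obtain ⟨π, hπ, h0⟩ := Multiset.mem_map.1 h0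
  have hp := prime_of_mem_factors hπ
  have ho := odd_norm_of_mem_factors hγ hπ
  obtain ⟨z, hz, hd⟩ := exists_value hp ho α
  rw [primeSymbol_eq hp ho hz hd, toComplex_eq_zero] at h0
  rw [h0, sub_zero] at hd
  exact hp.not_isUnit (h.isUnit_of_dvd' (hp.dvd_of_dvd_pow hd) (dvd_of_mem_factors hπ))

lemma symbol_eq_zero {γ : GaussianInt} (hγ : Odd γ.norm) {α : GaussianInt}
    (h : ¬ IsCoprime α γ) : symbol α γ = 0 := by
  have h0 := ne_zero_of_odd_norm hγ
  obtain ⟨π, hπ, h1, h2⟩ : ∃ π, Prime π ∧ π ∣ α ∧ π ∣ γ := by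
    by_contra hc
    push Not at hc
    exact h (isCoprime_of_prime_dvd (fun h => h0 h.2) fun π hπ h1 => hc π hπ h1)
  obtain ⟨ρ, hρ, has⟩ := exists_mem_factors_of_dvd h0 hπ.irreducible h2
  unfold symbol
  rw [Multiset.prod_eq_zero_iff]
  refine Multiset.mem_map.2 ⟨ρ, hρ, ?_⟩
  unfold primeSymbol
  rw [if_pos (has.symm.dvd.trans h1)]

lemma toComplex_I : toComplex ⟨0, 1⟩ = Complex.I := by simp [toComplex_def']

lemma symbol_one_left {γ : GaussianInt} (hγ : Odd γ.norm) : symbol 1 γ = 1 := by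
  have h := symbol_mul_left hγ 1 1
  have h0 := symbol_ne_zero hγ (isCoprime_one_left (x := γ))
  rw [mul_one] at h
  exact (mul_left_cancel₀ h0 (by rw [← h, mul_one])).symm

lemma symbol_pow_left {γ : GaussianInt} (hγ : Odd γ.norm) (α : GaussianInt) (n : ℕ) :
    symbol (α ^ n) γ = symbol α γ ^ n := by
  induction n with
  | zero => simp [symbol_one_left hγ]
  | succ n ih => rw [pow_succ, symbol_mul_left hγ, ih, pow_succ]

lemma symbol_pow_four {γ : GaussianInt} (hγ : Odd γ.norm) {α : GaussianInt} (h : IsCoprime α γ) :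
    symbol α γ ^ 4 = 1 := by
  obtain ⟨z, hz, h'⟩ := exists_symbol_eq hγ α
  have h0 := symbol_ne_zero hγ h
  rw [h'] at h0 ⊢
  rw [← map_pow, hz.pow_four (by rintro rfl; simp at h0), map_one]

lemma symbol_mul_star {γ : GaussianInt} (hγ : Odd γ.norm) {α : GaussianInt} (h : IsCoprime α γ) :
    symbol α γ * star (symbol α γ) = 1 := by
  obtain ⟨z, hz, h'⟩ := exists_symbol_eq hγ α
  have h0 := symbol_ne_zero hγ h
  rw [h'] at h0 ⊢
  have := hz.mul_star (by rintro rfl; simp at h0)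
  have h2 := congrArg toComplex this
  rw [map_mul, toComplex_star, map_one] at h2
  exact h2

lemma exists_symbol_eq_zpow {γ : GaussianInt} (hγ : Odd γ.norm) {α : GaussianInt}
    (h0 : symbol α γ ≠ 0) : ∃ e : ℤ, symbol α γ = Complex.I ^ e := by
  obtain ⟨z, hz, h'⟩ := exists_symbol_eq hγ α
  rw [h'] at h0 ⊢
  rcases hz with rfl | rfl | rfl | rfl | rfl
  · simp at h0
  · exact ⟨0, by simp⟩
  · exact ⟨1, by simp [toComplex_I]⟩
  · exact ⟨2, by rw [map_neg, map_one]; norm_cast; simp⟩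
  · exact ⟨-1, by rw [toComplex_def']; simp⟩

/-! ### Supplementary laws and rational arguments -/

lemma symbolExponent_mul {a b : GaussianInt} (ha : Odd a.norm) (hb : Odd b.norm) :
    symbolExponent (a * b) =
      4 * (symbolExponent a * symbolExponent b) + symbolExponent a + symbolExponent b := by
  have h1 := four_mul_symbolExponent ha
  have h2 := four_mul_symbolExponent hb
  have h1' := norm_mod_four ha
  have h2' := norm_mod_four hb
  have h3 : a.norm.natAbs = 4 * symbolExponent a + 1 := by omega
  have h4 : b.norm.natAbs = 4 * symbolExponent b + 1 := by omega
  rw [symbolExponent, Zsqrtd.norm_mul, Int.natAbs_mul, h3, h4]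
  apply Nat.div_eq_of_eq_mul_right (by norm_num)
  apply Nat.sub_eq_of_eq_add
  ring

lemma symbol_I_left {γ : GaussianInt} (hγ : Odd γ.norm) :
    symbol ⟨0, 1⟩ γ = Complex.I ^ symbolExponent γ := by
  refine induction_on_odd_norm (P := fun γ => symbol ⟨0, 1⟩ γ = Complex.I ^ symbolExponent γ)
    (fun u h => ?_) (fun π γ hπ ho hγ h1 h2 => ?_) (fun π hπ ho => ?_) hγ
  · rw [symbol_of_isUnit h, symbolExponent, isUnit_iff_norm.1 h]
    simp
  · rw [symbol_mul_right (ne_zero_of_odd_norm ho) (ne_zero_of_odd_norm hγ), h1, h2,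
      symbolExponent_mul ho hγ, pow_add, pow_add, pow_mul, Complex.I_pow_four, one_pow, one_mul]
  · rw [symbol_prime hπ, primeSymbol_eq hπ ho (IsValue.pow (.inr (.inr (.inl rfl))) _)
      (by rw [sub_self]; exact dvd_zero _), map_pow, toComplex_I]

lemma symbol_neg_one_left {γ : GaussianInt} (hγ : Odd γ.norm) :
    symbol (-1) γ = (-1) ^ symbolExponent γ := by
  rw [show (-1 : GaussianInt) = ⟨0, 1⟩ * ⟨0, 1⟩ by decide, symbol_mul_left hγ, symbol_I_left hγ,
    ← mul_pow, Complex.I_mul_I]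

lemma odd_norm_intCast {m : ℤ} (hm : Odd m) : Odd (m : GaussianInt).norm := by
  rw [Zsqrtd.norm_intCast]
  exact hm.mul hm

lemma intCast_isCoprime {m n : ℤ} (h : IsCoprime m n) :
    IsCoprime (m : GaussianInt) (n : GaussianInt) :=
  h.map (Int.castRingHom GaussianInt)

lemma isCoprime_of_intCast {m n : ℤ} (h : IsCoprime (m : GaussianInt) (n : GaussianInt)) :
    IsCoprime m n := by
  obtain ⟨a, b, hab⟩ := h
  exact ⟨a.re, b.re, by simpa using congrArg Zsqrtd.re hab⟩

lemma symbol_neg_right (α γ : GaussianInt) : symbol α (-γ) = symbol α γ :=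
  symbol_associated (Associated.neg_left (Associated.refl _)) α

lemma prime_of_norm_prime {π : GaussianInt} {p : ℕ} (hp : p.Prime) (h : π.norm = p) :
    Prime π := by
  refine Irreducible.prime ⟨fun hu => ?_, fun a b hab => ?_⟩
  · rw [isUnit_iff_norm, h] at hu
    exact hp.one_lt.ne' (by exact_mod_cast hu)
  · have h1 : a.norm.natAbs * b.norm.natAbs = p := by
      rw [← Int.natAbs_mul, ← Zsqrtd.norm_mul, ← hab, h, Int.natAbs_natCast]
    have h2 := abs_natCast_norm a
    have h3 := abs_natCast_norm b
    rw [isUnit_iff_norm, isUnit_iff_norm]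
    rcases Nat.prime_mul_iff.1 (h1 ▸ hp) with ⟨-, h⟩ | ⟨-, h⟩
    · right; omega
    · left; omega

lemma exists_split_prime {p : ℕ} (hp : p.Prime) (h1 : p % 4 = 1) :
    ∃ π : GaussianInt, Prime π ∧ π.norm = p ∧ (p : GaussianInt) = π * star π := by
  have : Fact p.Prime := ⟨hp⟩
  obtain ⟨a, b, h⟩ := Nat.Prime.sq_add_sq (p := p) (by omega)
  have hN : (⟨a, b⟩ : GaussianInt).norm = p := by
    rw [← h]; simp [Zsqrtd.norm]; ring
  refine ⟨_, prime_of_norm_prime hp hN, hN, ?_⟩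
  rw [← Zsqrtd.norm_eq_mul_conj, hN]
  simp

lemma symbol_split {π : GaussianInt} (ho : Odd π.norm) (α : GaussianInt) :
    symbol α (π * star π) = symbol α π * star (symbol (star α) π) := by
  have h0 := ne_zero_of_odd_norm ho
  rw [symbol_mul_right h0 (by simpa using h0), ← symbol_star ho, star_star]

/-- For inert `p` the exponent is `(p² - 1)/4 = (p - 1)(p + 1)/4`; this factored form lets one apply
Fermat or Frobenius to the `(p - 1)`-st power first. -/
lemma symbol_inert {p : ℕ} (hp : p.Prime) (h3 : p % 4 = 3) {α z : GaussianInt} (hz : IsValue z)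
    (h : (p : GaussianInt) ∣ α ^ ((p - 1) * ((p + 1) / 4)) - z) :
    symbol α p = toComplex z := by
  have : Fact p.Prime := ⟨hp⟩
  have hπ := prime_of_nat_prime_of_mod_four_eq_three p h3
  have ho : Odd (p : GaussianInt).norm := by
    rw [← Int.cast_natCast]
    exact odd_norm_intCast (by rw [Int.odd_iff]; omega)
  rw [symbol_prime hπ, primeSymbol_eq hπ ho hz]
  convert h using 3
  rw [symbolExponent, Zsqrtd.norm_natCast, Int.natAbs_mul, Int.natAbs_natCast]
  obtain ⟨k, rfl⟩ : ∃ k, p = 4 * k + 3 := ⟨p / 4, by omega⟩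
  rw [show (4 * k + 3 - 1) * ((4 * k + 3 + 1) / 4) = (4 * k + 2) * (k + 1) by
    rw [show (4 * k + 3 + 1) / 4 = k + 1 by omega]; congr 1]
  apply Nat.div_eq_of_eq_mul_right (by norm_num)
  apply Nat.sub_eq_of_eq_add
  ring

/-- Induction over the integers `n ≡ 1 (mod 4)`, one rational prime factor at a time. -/
lemma induction_one_mod_four {P : ℤ → Prop} (one : P 1)
    (mul : ∀ a b, a % 4 = 1 → b % 4 = 1 → P a → P b → P (a * b))
    (split : ∀ p : ℕ, p.Prime → p % 4 = 1 → P p) (inert : ∀ p : ℕ, p.Prime → p % 4 = 3 → P (-p))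
    {n : ℤ} (hn : n % 4 = 1) : P n := by
  -- Each prime `≡ 3 (mod 4)` carries a sign, so both residue classes must be followed at once
  -- through the factorization of the absolute value.
  have key : ∀ m : ℕ, (m % 4 = 1 → P m) ∧ (m % 4 = 3 → P (-m)) := by
    intro m
    induction m using induction_on_primes with
    | zero => simp
    | one => simpa using one
    | prime_mul p m hp ih =>
      have hm := Nat.mul_mod p m 4
      have h4 : m % 4 < 4 := Nat.mod_lt _ (by norm_num)
      have h4' : p % 4 < 4 := Nat.mod_lt _ (by norm_num)
      constructor
      · intro h
        rw [h] at hm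
        have : (p % 4 = 1 ∧ m % 4 = 1) ∨ (p % 4 = 3 ∧ m % 4 = 3) := by
          generalize p % 4 = s at *
          generalize m % 4 = t at *
          interval_cases s <;> interval_cases t <;> omega
        rcases this with ⟨h1, h2⟩ | ⟨h1, h2⟩
        · push_cast
          exact mul _ _ (by omega) (by omega) (split p hp h1) (ih.1 h2)
        · push_cast
          rw [← neg_mul_neg]
          exact mul _ _ (by omega) (by omega) (inert p hp h1) (ih.2 h2)
      · intro h
        rw [h] at hm
        have : (p % 4 = 1 ∧ m % 4 = 3) ∨ (p % 4 = 3 ∧ m % 4 = 1) := by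
          generalize p % 4 = s at *
          generalize m % 4 = t at *
          interval_cases s <;> interval_cases t <;> omega
        rcases this with ⟨h1, h2⟩ | ⟨h1, h2⟩
        · push_cast
          rw [← mul_neg]
          exact mul _ _ (by omega) (by omega) (split p hp h1) (ih.2 h2)
        · push_cast
          rw [← neg_mul]
          exact mul _ _ (by omega) (by omega) (inert p hp h1) (ih.1 h2)
  rcases Int.natAbs_eq n with h | h
  · rw [h]; exact (key _).1 (by omega)
  · rw [h]; exact (key _).2 (by omega)

lemma intCast_ne_zero_of_mod_four {n : ℤ} (h : n % 4 = 1) : (n : GaussianInt) ≠ 0 := by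
  rw [Int.cast_ne_zero]
  omega

/-- At a split prime the two conjugate factors contribute a root of unity and its conjugate; at an
inert prime `p` the exponent is a multiple of `p - 1` and Fermat applies. -/
lemma symbol_intCast_intCast {m n : ℤ} (hm : Odd m) (h : IsCoprime n m) :
    symbol (n : GaussianInt) (m : GaussianInt) = 1 := by
  have key : ∀ m : ℤ, m % 4 = 1 → IsCoprime n m → symbol (n : GaussianInt) m = 1 := by
    intro m hm
    refine induction_one_mod_four
      (P := fun m => IsCoprime n m → symbol (n : GaussianInt) m = 1) ?_ ?_ ?_ ?_ hm
    · intro _; exact symbol_of_isUnit (by simp) _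
    · intro a b ha hb iha ihb h
      rw [Int.cast_mul, symbol_mul_right (intCast_ne_zero_of_mod_four ha)
        (intCast_ne_zero_of_mod_four hb), iha h.of_mul_right_left, ihb h.of_mul_right_right, mul_one]
    · intro p hp h1 h
      obtain ⟨π, hπ, hN, he⟩ := exists_split_prime hp h1
      have ho : Odd π.norm := by rw [hN, Int.odd_iff]; omega
      have hc : IsCoprime (n : GaussianInt) π := by
        have := intCast_isCoprime h
        rw [Int.cast_natCast, he] at this
        exact this.of_mul_right_left
      have hs : star (n : GaussianInt) = n := by ext <;> simp
      rw [Int.cast_natCast, he, symbol_split ho, hs, symbol_mul_star ho hc]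
    · intro p hp h3 h
      have hp' : Fact p.Prime := ⟨hp⟩
      rw [Int.cast_neg, Int.cast_natCast, symbol_neg_right]
      refine (symbol_inert hp h3 .one ?_).trans (map_one _)
      have hd : (p : ℤ) ∣ n ^ ((p - 1) * ((p + 1) / 4)) - 1 := by
        rw [← ZMod.intCast_zmod_eq_zero_iff_dvd]
        have hn : (n : ZMod p) ≠ 0 := by
          rw [Ne, ZMod.intCast_zmod_eq_zero_iff_dvd]
          intro hd
          have := h.isUnit_of_dvd' hd (dvd_neg.2 dvd_rfl)
          rw [Int.isUnit_iff] at this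
          have := hp.one_lt
          omega
        push_cast
        rw [pow_mul, ZMod.pow_card_sub_one_eq_one hn, one_pow, sub_self]
      have := (Int.castRingHom GaussianInt).map_dvd hd
      simpa using this
  rcases Int.odd_iff.1 hm with h2
  rcases (by omega : m % 4 = 1 ∨ (-m) % 4 = 1) with h4 | h4
  · exact key m h4 h
  · rw [← key (-m) h4 h.neg_right, Int.cast_neg, symbol_neg_right]

lemma I_zpow_of_modEq {a b : ℤ} (h : a ≡ b [ZMOD 4]) : Complex.I ^ a = Complex.I ^ b := by
  obtain ⟨k, hk⟩ := h.dvd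
  rw [show b = a + 4 * k by omega, zpow_add₀ Complex.I_ne_zero, zpow_mul,
    show Complex.I ^ (4 : ℤ) = 1 by norm_cast; exact Complex.I_pow_four, one_zpow, mul_one]

lemma modEq_of_I_zpow {a b : ℤ} (h : Complex.I ^ a = Complex.I ^ b) : a ≡ b [ZMOD 4] := by
  have h1 : Complex.I ^ (a - b) = 1 := by
    rw [zpow_sub₀ Complex.I_ne_zero, h, div_self (zpow_ne_zero _ Complex.I_ne_zero)]
  have h2 : Complex.I ^ ((a - b) % 4) = 1 := by
    rw [I_zpow_of_modEq (Int.mod_modEq _ _), h1]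
  have h3 : 0 ≤ (a - b) % 4 := by omega
  have h4 : (a - b) % 4 < 4 := by omega
  have h5 : (a - b) % 4 = 0 := by
    have i2 : Complex.I ^ (2 : ℤ) = -1 := (zpow_ofNat _ 2).trans Complex.I_sq
    have i3 : Complex.I ^ (3 : ℤ) = -Complex.I := by norm_cast; exact Complex.I_pow_three
    interval_cases (a - b) % 4
    · rfl
    · simp [Complex.ext_iff] at h2
    · rw [i2] at h2; norm_num at h2
    · rw [i3] at h2; simp [Complex.ext_iff] at h2
  exact Int.ModEq.symm (Int.modEq_iff_dvd.2 (Int.dvd_of_emod_eq_zero h5))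

lemma isCoprime_one_add_I {γ : GaussianInt} (hγ : Odd γ.norm) :
    IsCoprime (⟨1, 1⟩ : GaussianInt) γ := by
  have h : Prime (⟨1, 1⟩ : GaussianInt) := prime_of_norm_prime Nat.prime_two (by decide)
  rw [h.irreducible.coprime_iff_not_dvd]
  intro hd
  have := odd_norm_of_dvd hd hγ
  exact absurd this (by decide)

/-- The supplementary law for `1 + i` at a rational integer. -/
lemma symbol_one_add_I_left {n : ℤ} (hn : n % 4 = 1) :
    symbol ⟨1, 1⟩ n = Complex.I ^ ((n - 1) / 4) := by
  refine induction_one_mod_four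
    (P := fun n : ℤ => symbol ⟨1, 1⟩ n = Complex.I ^ ((n - 1) / 4)) ?_ ?_ ?_ ?_ hn
  · simpa using symbol_of_isUnit (by simp) _
  · intro a b ha hb iha ihb
    rw [Int.cast_mul, symbol_mul_right (intCast_ne_zero_of_mod_four ha)
      (intCast_ne_zero_of_mod_four hb), iha, ihb, ← zpow_add₀ Complex.I_ne_zero]
    apply I_zpow_of_modEq
    obtain ⟨k, rfl⟩ : ∃ k, a = 4 * k + 1 := ⟨a / 4, by omega⟩
    obtain ⟨l, rfl⟩ : ∃ l, b = 4 * l + 1 := ⟨b / 4, by omega⟩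
    rw [show (4 * k + 1) * (4 * l + 1) - 1 = 4 * (4 * (k * l) + k + l) by ring]
    unfold Int.ModEq
    omega
  · intro p hp h1
    obtain ⟨π, hπ, hN, he⟩ := exists_split_prime hp h1
    have ho : Odd π.norm := by rw [hN, Int.odd_iff]; omega
    have h2 := symbol_mul_star ho (isCoprime_one_add_I ho)
    have h3 := symbol_mul_star ho (α := ⟨0, -1⟩) (γ := π) ⟨⟨0, 1⟩, 0, by
      rw [zero_mul, add_zero]; decide⟩
    have h4 := symbol_mul_left ho ⟨0, 1⟩ ⟨0, -1⟩
    rw [show (⟨0, 1⟩ : GaussianInt) * ⟨0, -1⟩ = 1 by decide, symbol_one_left ho] at h4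
    have hI := symbol_I_left ho
    -- Since `1 - i = -i(1 + i)`, the contributions of `1 + i` at the conjugate primes cancel up to
    -- the conjugate of the symbol of `-i`, which is the symbol of `i`.
    rw [Int.cast_natCast, he, symbol_split ho, show star (⟨1, 1⟩ : GaussianInt) =
      ⟨0, -1⟩ * ⟨1, 1⟩ by decide, symbol_mul_left ho, star_mul']
    have he' : symbolExponent π = (p - 1) / 4 := by rw [symbolExponent, hN, Int.natAbs_natCast]
    rw [show ((p : ℤ) - 1) / 4 = ((symbolExponent π : ℕ) : ℤ) by omega, zpow_natCast, ← hI]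
    linear_combination star (symbol ⟨0, -1⟩ π) * h2 + symbol ⟨0, 1⟩ π * h3
      + star (symbol ⟨0, -1⟩ π) * h4
  · intro p hp h3
    have hp' : Fact p.Prime := ⟨hp⟩
    have hv : IsValue ((⟨0, -1⟩ : GaussianInt) ^ ((p + 1) / 4)) :=
      IsValue.pow (.inr (.inr (.inr (.inr rfl)))) _
    rw [Int.cast_neg, Int.cast_natCast, symbol_neg_right]
    refine (symbol_inert hp h3 hv ?_).trans ?_
    · rw [pow_mul]
      refine dvd_trans ?_ (sub_dvd_pow_sub_pow _ _ _)
      have hπ := prime_of_nat_prime_of_mod_four_eq_three p h3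
      -- Frobenius gives `(1 + i)^p ≡ 1 - i = -i(1 + i)`; cancelling, `(1 + i)^(p-1) ≡ -i`.
      have h := dvd_pow_sub_star hp h3 ⟨1, 1⟩
      rw [show p = p - 1 + 1 by omega, pow_succ, show star (⟨1, 1⟩ : GaussianInt) =
        ⟨0, -1⟩ * ⟨1, 1⟩ by decide, ← sub_mul] at h
      rw [show p - 1 + 1 = p by omega] at h
      have ho : Odd (p : GaussianInt).norm := by
        rw [← Int.cast_natCast]
        exact odd_norm_intCast (by rw [Int.odd_iff]; omega)
      exact (isCoprime_one_add_I ho).symm.dvd_of_dvd_mul_right h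
    · rw [map_pow, show toComplex ⟨0, -1⟩ = Complex.I ^ (-1 : ℤ) by rw [toComplex_def']; simp,
        ← zpow_natCast, ← zpow_mul]
      congr 1
      push_cast
      omega

/-- This follows from `(1 + i)⁴ = -4`, as fourth powers of units have symbol 1. -/
lemma symbol_two_pow_two {γ : GaussianInt} (hγ : Odd γ.norm) :
    symbol 2 γ ^ 2 = symbol (-1) γ := by
  have h := symbol_pow_four hγ (isCoprime_one_add_I hγ)
  rw [← symbol_pow_left hγ, show (⟨1, 1⟩ : GaussianInt) ^ 4 = (-1) * 2 ^ 2 by decide,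
    symbol_mul_left hγ, symbol_pow_left hγ] at h
  have h' : symbol (-1) γ * symbol (-1) γ = 1 := by
    rw [← symbol_mul_left hγ, neg_mul_neg, one_mul, symbol_one_left hγ]
  linear_combination symbol (-1) γ * h - symbol 2 γ ^ 2 * h'

lemma cases_of_isUnit {u : GaussianInt} (h : IsUnit u) :
    u = 1 ∨ u = -1 ∨ u = ⟨0, 1⟩ ∨ u = ⟨0, -1⟩ := by
  rw [isUnit_iff_norm] at h
  obtain ⟨a, b⟩ := u
  have e : a * a + b * b = 1 := by rw [← h]; simp [Zsqrtd.norm]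
  have ha : -1 ≤ a ∧ a ≤ 1 := by constructor <;> nlinarith [mul_self_nonneg b]
  have hb : -1 ≤ b ∧ b ≤ 1 := by constructor <;> nlinarith [mul_self_nonneg a]
  obtain ⟨ha1, ha2⟩ := ha
  obtain ⟨hb1, hb2⟩ := hb
  interval_cases a <;> interval_cases b <;> first | omega | decide

lemma odd_norm_iff {γ : GaussianInt} : Odd γ.norm ↔ Odd (γ.re + γ.im) := by
  simp only [Zsqrtd.norm]
  rw [Int.odd_sub, Int.odd_add, Int.odd_mul, Int.even_mul, Int.even_mul]
  simp [← Int.not_odd_iff_even]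

/-! ### Quartic characters and their Jacobi sums -/

lemma isPrimitiveRoot_I : IsPrimitiveRoot (⟨0, 1⟩ : GaussianInt) 4 :=
  IsPrimitiveRoot.mk_of_lt _ (by norm_num) (by decide) fun l h1 h2 => by
    interval_cases l <;> decide

/-- A multiplicative character `χ` modulo `p` with values in the Gaussian integers which lifts
`a ↦ a ^ ((p - 1) / 4)` through the residue map `f`. -/
structure IsQuarticLift {p : ℕ} (f : GaussianInt →+* ZMod p) (χ : MulChar (ZMod p) GaussianInt) :
    Prop where
  isValue : ∀ a, IsValue (χ a)
  map_apply : ∀ a, f (χ a) = a ^ ((p - 1) / 4)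

section Character

variable {p : ℕ} [Fact p.Prime] {π : GaussianInt} {f : GaussianInt →+* ZMod p}

lemma IsValue.eq_of_map_eq (hp : p % 4 = 1) (hN : π.norm = p) (hf : ∀ α, f α = 0 ↔ π ∣ α)
    {z w : GaussianInt} (hz : IsValue z) (hw : IsValue w) (h : f z = f w) : z = w := by
  have hπ := prime_of_norm_prime Fact.out hN
  refine hz.eq_of_dvd_sub hw hπ.not_isUnit (by rw [hN, Int.odd_iff]; omega) ?_
  rw [← hf, map_sub, h, sub_self]

lemma exists_isQuarticLift (hp : p % 4 = 1) (hN : π.norm = p) (hf : ∀ α, f α = 0 ↔ π ∣ α) :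
    ∃ χ, IsQuarticLift f χ := by
  have hπ := prime_of_norm_prime Fact.out hN
  have ho : Odd π.norm := by rw [hN, Int.odd_iff]; omega
  have he : symbolExponent π = (p - 1) / 4 := by rw [symbolExponent, hN, Int.natAbs_natCast]
  have hex : ∀ a : ZMod p, ∃ z, IsValue z ∧ f z = a ^ ((p - 1) / 4) := by
    intro a
    obtain ⟨z, hz, hd⟩ := exists_value hπ ho (a.val : GaussianInt)
    refine ⟨z, hz, ?_⟩
    rw [← hf, map_sub, map_pow, map_natCast, ZMod.natCast_zmod_val, he, sub_eq_zero] at hd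
    exact hd.symm
  choose z hz hfz using hex
  have hp1 : (p - 1) / 4 ≠ 0 := by
    have := (Fact.out : p.Prime).two_le
    omega
  refine ⟨{ toFun := z, map_one' := ?_, map_mul' := ?_, map_nonunit' := ?_ }, ⟨hz, hfz⟩⟩
  · exact (hz _).eq_of_map_eq hp hN hf .one (by rw [hfz, map_one, one_pow])
  · intro a b
    exact (hz _).eq_of_map_eq hp hN hf ((hz a).mul (hz b)) (by
      rw [map_mul, hfz, hfz, hfz, mul_pow])
  · intro a ha
    rw [isUnit_iff_ne_zero, not_not] at ha
    exact (hz _).eq_of_map_eq hp hN hf (.inl rfl) (by rw [hfz, map_zero, ha, zero_pow hp1])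

variable {χ : MulChar (ZMod p) GaussianInt}

lemma IsQuarticLift.ne_zero (h : IsQuarticLift f χ) {a : ZMod p} (ha : a ≠ 0) : χ a ≠ 0 := by
  intro h0
  have := h.map_apply a
  rw [h0, map_zero] at this
  exact pow_ne_zero _ ha this.symm

lemma IsQuarticLift.pow_four (h : IsQuarticLift f χ) : χ ^ 4 = 1 := by
  refine MulChar.ext fun a => ?_
  rw [MulChar.pow_apply_coe, (h.isValue _).pow_four (h.ne_zero a.ne_zero), MulChar.one_apply_coe]

/-- The square of `χ` lifts `a ↦ a ^ ((p - 1) / 2)`, which is not identically 1 on units by Euler's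
criterion at a nonsquare. -/
lemma IsQuarticLift.sq_ne_one (hp : p % 4 = 1) (h : IsQuarticLift f χ) : χ * χ ≠ 1 := by
  intro h1
  obtain ⟨a, ha⟩ := FiniteField.exists_nonsquare (F := ZMod p) (by rw [ZMod.ringChar_zmod_n]; omega)
  have ha0 : a ≠ 0 := by rintro rfl; exact ha ⟨0, by simp⟩
  rw [ZMod.euler_criterion p ha0] at ha
  apply ha
  have h2 : (χ * χ) a = 1 := by rw [h1, MulChar.one_apply (isUnit_iff_ne_zero.2 ha0)]
  rw [MulChar.mul_apply] at h2
  have := congrArg f h2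
  rw [map_mul, h.map_apply, map_one, ← pow_add] at this
  rw [← this]
  congr 1
  omega

lemma IsQuarticLift.inv_apply (h : IsQuarticLift f χ) (a : ZMod p) : χ⁻¹ a = star (χ a) := by
  by_cases ha : a = 0
  · rw [ha, MulChar.map_zero, MulChar.map_zero, star_zero]
  have h1 := (h.isValue a).mul_star (h.ne_zero ha)
  have h2 : χ a * χ⁻¹ a = 1 := by
    rw [← MulChar.mul_apply, mul_inv_cancel, MulChar.one_apply (isUnit_iff_ne_zero.2 ha)]
  exact mul_left_cancel₀ (h.ne_zero ha) (h2.trans h1.symm)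

/-- Modulo `π` the Jacobi sum is the sum over `a` of `a^e (1 - a)^e` with `e = (p - 1)/4`. The
degree `2e` is below `p - 1`, so all the power sums vanish. -/
lemma IsQuarticLift.map_jacobiSum (hp : p % 4 = 1) (h : IsQuarticLift f χ) :
    f (jacobiSum χ χ) = 0 := by
  have hp2 := (Fact.out : p.Prime).two_le
  simp only [jacobiSum, map_sum, map_mul, h.map_apply]
  simp_rw [sub_eq_neg_add, add_pow, Finset.mul_sum]
  rw [Finset.sum_comm]
  refine Finset.sum_eq_zero fun k hk => ?_
  have hk' := Finset.mem_range.1 hk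
  have hs := FiniteField.sum_pow_lt_card_sub_one (ZMod p) ((p - 1) / 4 + k) (by
    rw [ZMod.card]; omega)
  calc _ = ∑ a : ZMod p, ((-1) ^ k * (((p - 1) / 4).choose k : ZMod p)) * a ^ ((p - 1) / 4 + k) :=
        Finset.sum_congr rfl fun a _ => by rw [one_pow, neg_pow, pow_add]; ring
    _ = 0 := by rw [← Finset.mul_sum, hs, mul_zero]

lemma IsQuarticLift.ne_one (hp : p % 4 = 1) (h : IsQuarticLift f χ) : χ ≠ 1 := by
  intro h1
  exact h.sq_ne_one hp (by rw [h1, mul_one])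

lemma IsQuarticLift.jacobiSum_mul_star (hp : p % 4 = 1) (h : IsQuarticLift f χ) :
    jacobiSum χ χ * star (jacobiSum χ χ) = p := by
  have h1 : star (jacobiSum χ χ) = jacobiSum χ⁻¹ χ⁻¹ := by
    simp only [jacobiSum, star_sum, star_mul', h.inv_apply]
  apply toComplex_injective
  have hχ : χ.ringHomComp toComplex ≠ 1 :=
    (MulChar.ringHomComp_ne_one_iff toComplex_injective).2 (h.ne_one hp)
  have hχ2 : χ.ringHomComp toComplex * χ.ringHomComp toComplex ≠ 1 := by
    rw [← MulChar.ringHomComp_mul]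
    exact (MulChar.ringHomComp_ne_one_iff toComplex_injective).2 (h.sq_ne_one hp)
  have := jacobiSum_mul_jacobiSum_inv (F := ZMod p) (F' := ℂ) (by
    rw [ZMod.ringChar_zmod_n, ringChar.eq_zero]
    exact (Fact.out : p.Prime).ne_zero.symm) hχ hχ hχ2
  rw [MulChar.ringHomComp_inv, jacobiSum_ringHomComp, jacobiSum_ringHomComp, ZMod.card] at this
  rw [h1, map_mul, this, map_natCast]

/-- The Jacobi sum is divisible by `π` and has norm `p`, so it is `π` times a unit. Being `≡ -1`
modulo `(i - 1)² = -2i`, it has even imaginary part, as does `π`; the unit is thus `±1`, and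
squaring removes the sign. -/
lemma IsQuarticLift.jacobiSum_sq (hp : p % 4 = 1) (hN : π.norm = p) (hf : ∀ α, f α = 0 ↔ π ∣ α)
    (hi : Even π.im) (h : IsQuarticLift f χ) : jacobiSum χ χ ^ 2 = π ^ 2 := by
  obtain ⟨w, hw⟩ := (hf _).1 (h.map_jacobiSum hp)
  have hp0 : (p : GaussianInt) ≠ 0 := Nat.cast_ne_zero.2 (Fact.out : p.Prime).ne_zero
  have hpe : π * star π = p := by rw [← Zsqrtd.norm_eq_mul_conj, hN]; simp
  have hwu : IsUnit w := by
    refine IsUnit.of_mul_eq_one (star w) (mul_left_cancel₀ hp0 ?_)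
    have := h.jacobiSum_mul_star hp
    rw [hw, star_mul'] at this
    linear_combination this - w * star w * hpe
  obtain ⟨z, -, hz⟩ := exists_jacobiSum_eq_neg_one_add (n := 4) (by norm_num) h.pow_four h.pow_four
    (by rw [ZMod.card]; omega) isPrimitiveRoot_I
  have ho : Odd (π.re + π.im) := by
    rw [← odd_norm_iff, hN, Int.odd_iff]; omega
  have hre : Odd π.re := by rwa [Int.odd_add, iff_true_right hi] at ho
  have h2 : ((⟨0, 1⟩ : GaussianInt) - 1) ^ 2 = ⟨0, -2⟩ := by decide
  rw [h2, hw] at hz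
  have him := congrArg Zsqrtd.im hz
  rcases cases_of_isUnit hwu with rfl | rfl | rfl | rfl
  · rw [hw, mul_one]
  · rw [hw]; ring
  all_goals
    simp at him
    obtain ⟨k, hk⟩ := hre
    omega

end Character

/-! ### Quartic Gauss sums in characteristic `l` -/

lemma dvd_of_map_eq_zero {F : Type*} [Field F] (φ : GaussianInt →+* F) {ρ α : GaussianInt}
    (hρ : Prime ρ) (h1 : φ ρ = 0) (h2 : φ α = 0) : ρ ∣ α := by
  by_contra hd
  obtain ⟨a, b, hab⟩ := hρ.irreducible.coprime_iff_not_dvd.2 hd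
  have := congrArg φ hab
  rw [map_add, map_mul, map_mul, h1, h2, map_one, mul_zero, mul_zero, add_zero] at this
  exact zero_ne_one this

section GaussSum

variable {p : ℕ} [Fact p.Prime] {π : GaussianInt} {f : GaussianInt →+* ZMod p}
  {χ : MulChar (ZMod p) GaussianInt} {F : Type*} [Field F] (φ : GaussianInt →+* F)

/-- Writing `G` for Gauss and `J` for Jacobi sums, `G(χ)² = J(χ, χ) G(χ²)`. The character `χ²` is
quadratic with `χ²(-1) = 1`, so `G(χ²)² = p = π star π`, and `J² = π²`. -/
lemma IsQuarticLift.gaussSum_pow_four (hp : p % 4 = 1) (hN : π.norm = p)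
    (hf : ∀ α, f α = 0 ↔ π ∣ α) (hi : Even π.im) (h : IsQuarticLift f χ)
    (hinj : (χ.ringHomComp φ) * (χ.ringHomComp φ) ≠ 1)
    {ψ : AddChar (ZMod p) F} (hψ : ψ.IsPrimitive) :
    gaussSum (χ.ringHomComp φ) ψ ^ 4 = φ (π ^ 3 * star π) := by
  set η := χ.ringHomComp φ with hη
  have hpe : π * star π = p := by rw [← Zsqrtd.norm_eq_mul_conj, hN]; simp
  have h4 : η ^ 4 = 1 := by rw [hη, MulChar.ringHomComp_pow, h.pow_four, MulChar.ringHomComp_one]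
  have h1 := jacobiSum_mul_nontrivial hinj ψ
  have hinv : (η * η)⁻¹ = η * η := by
    rw [inv_eq_iff_mul_eq_one, ← h4, ← pow_two, ← pow_two, ← pow_mul]
  have h2 := gaussSum_mul_gaussSum_eq_card hinj hψ
  rw [hinv, ← mul_gaussSum_inv_eq_gaussSum, ZMod.card] at h2
  have h3 : (η * η) (-1) = 1 := by
    rw [MulChar.mul_apply, ← map_mul, neg_mul_neg, one_mul, map_one]
  have h5 := mul_gaussSum_inv_eq_gaussSum (η * η) ψ
  rw [h3, one_mul] at h2 h5
  rw [h5] at h2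
  rw [jacobiSum_ringHomComp] at h1
  have h6 : φ (jacobiSum χ χ) ^ 2 = φ (π ^ 2) := by
    rw [← map_pow, h.jacobiSum_sq hp hN hf hi]
  have h7 : φ (π * star π) = p := by rw [hpe, map_natCast]
  rw [map_pow] at h6
  rw [map_mul] at h7
  rw [map_mul, map_pow]
  calc gaussSum η ψ ^ 4 = (gaussSum η ψ * gaussSum η ψ) ^ 2 := by ring
    _ = gaussSum (η * η) ψ * gaussSum (η * η) ψ * φ (jacobiSum χ χ) ^ 2 := by rw [← h1]; ring
    _ = _ := by rw [h2, h6, ← h7]; ring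

variable {l : ℕ} [Fact l.Prime] [CharP F l]

/-- A difference of distinct values divides 4, which is nonzero in odd characteristic. Identities
between symbols can therefore be checked in `F`. -/
lemma IsValue.eq_of_map_eq_of_odd (hl : Odd l) {z w : GaussianInt} (hz : IsValue z)
    (hw : IsValue w) (h : φ z = φ w) : z = w := by
  by_contra hne
  have h1 : (z - w) ∣ 4 := by
    obtain ⟨c, hc⟩ := hz.sub_norm_dvd hw hne
    refine ⟨star (z - w) * c, ?_⟩
    rw [← mul_assoc, ← Zsqrtd.norm_eq_mul_conj]
    exact_mod_cast congrArg (Int.cast : ℤ → GaussianInt) hc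
  have h2 := map_dvd φ h1
  rw [map_sub, h, sub_self, zero_dvd_iff, map_ofNat] at h2
  have h3 : ((4 : ℕ) : F) = 0 := by exact_mod_cast h2
  rw [CharP.cast_eq_zero_iff F l] at h3
  have h4 : l ∣ 2 := (Fact.out : l.Prime).dvd_of_dvd_pow (n := 2) h3
  have := (Nat.prime_dvd_prime_iff_eq Fact.out Nat.prime_two).1 h4
  rw [this] at hl
  exact absurd hl (by decide)

lemma IsQuarticLift.sq_ringHomComp_ne_one (hp : p % 4 = 1) (hl : Odd l)
    (h : IsQuarticLift f χ) : (χ.ringHomComp φ) * (χ.ringHomComp φ) ≠ 1 := by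
  intro h1
  apply h.sq_ne_one hp
  refine MulChar.ext fun a => ?_
  have h2 : ((χ.ringHomComp φ) * (χ.ringHomComp φ)) a = 1 := by rw [h1, MulChar.one_apply_coe]
  rw [MulChar.one_apply_coe, MulChar.mul_apply]
  refine ((h.isValue _).mul (h.isValue _)).eq_of_map_eq_of_odd φ hl .one ?_
  rw [map_mul, map_one]
  exact h2

/-- The action of Frobenius on the quartic Gauss sum, for `l ≡ 1 (mod 4)`. -/
lemma IsQuarticLift.frobenius_split (hp : p % 4 = 1) (hN : π.norm = p)
    (hf : ∀ α, f α = 0 ↔ π ∣ α) (hi : Even π.im) (h : IsQuarticLift f χ) (hl : l % 4 = 1)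
    (hpl : p ≠ l) {ψ : AddChar (ZMod p) F} (hψ : ψ.IsPrimitive) :
    φ (χ l) * φ (π ^ 3 * star π) ^ ((l - 1) / 4) = 1 := by
  have hlo : Odd l := by rw [Nat.odd_iff]; omega
  have hinj := h.sq_ringHomComp_ne_one φ hp hlo
  have hg4 := h.gaussSum_pow_four φ hp hN hf hi hinj hψ
  have h1 : χ.ringHomComp φ ≠ 1 := fun h1 => hinj (by rw [h1, mul_one])
  have hpF : ((Fintype.card (ZMod p) : ℕ) : F) ≠ 0 := by
    rw [ZMod.card, Ne, CharP.cast_eq_zero_iff F l]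
    exact fun hd => hpl ((Nat.prime_dvd_prime_iff_eq Fact.out Fact.out).1 hd).symm
  have hg0 := gaussSum_ne_zero_of_nontrivial hpF h1 hψ
  have hlu : IsUnit (l : ZMod p) := by
    rw [isUnit_iff_ne_zero, Ne, ZMod.natCast_eq_zero_iff]
    exact fun hd => hpl ((Nat.prime_dvd_prime_iff_eq Fact.out Fact.out).1 hd)
  have hfrob := gaussSum_frob l (χ.ringHomComp φ) ψ
  have h4 : (χ.ringHomComp φ) ^ 4 = 1 := by
    rw [MulChar.ringHomComp_pow, h.pow_four, MulChar.ringHomComp_one]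
  have hpow : (χ.ringHomComp φ) ^ l = χ.ringHomComp φ := by
    conv_lhs => rw [← Nat.div_add_mod l 4, hl, pow_add, pow_mul, h4, one_pow, one_mul, pow_one]
  have hsh := gaussSum_mulShift (χ.ringHomComp φ) ψ hlu.unit
  rw [hlu.unit_spec, ← AddChar.pow_mulShift, ← hpow, ← hfrob, hpow, MulChar.ringHomComp_apply] at hsh
  apply mul_right_cancel₀ hg0
  rw [← hg4, ← pow_mul, one_mul, mul_assoc, ← pow_succ]
  rwa [show 4 * ((l - 1) / 4) + 1 = l by omega]

/-- The action of Frobenius on the quartic Gauss sum, for `l ≡ 3 (mod 4)`. -/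
lemma IsQuarticLift.frobenius_inert (hp : p % 4 = 1) (hN : π.norm = p)
    (hf : ∀ α, f α = 0 ↔ π ∣ α) (hi : Even π.im) (h : IsQuarticLift f χ) (hl : l % 4 = 3)
    (hpl : p ≠ l) {ψ : AddChar (ZMod p) F} (hψ : ψ.IsPrimitive) :
    φ (π ^ 3 * star π) ^ ((l + 1) / 4) = φ (χ (-l)) * φ (π * star π) := by
  have hlo : Odd l := by rw [Nat.odd_iff]; omega
  have hinj := h.sq_ringHomComp_ne_one φ hp hlo
  have hg4 := h.gaussSum_pow_four φ hp hN hf hi hinj hψ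
  have h1 : χ.ringHomComp φ ≠ 1 := fun h1 => hinj (by rw [h1, mul_one])
  have hpe : π * star π = p := by rw [← Zsqrtd.norm_eq_mul_conj, hN]; simp
  have hlu : IsUnit (l : ZMod p) := by
    rw [isUnit_iff_ne_zero, Ne, ZMod.natCast_eq_zero_iff]
    exact fun hd => hpl ((Nat.prime_dvd_prime_iff_eq Fact.out Fact.out).1 hd)
  have hfrob := gaussSum_frob l (χ.ringHomComp φ) ψ
  have h4 : (χ.ringHomComp φ) ^ 4 = 1 := by
    rw [MulChar.ringHomComp_pow, h.pow_four, MulChar.ringHomComp_one]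
  have h3 : (χ.ringHomComp φ) ^ 3 = (χ.ringHomComp φ)⁻¹ := by
    rw [eq_inv_iff_mul_eq_one, ← pow_succ, h4]
  have hpow : (χ.ringHomComp φ) ^ l = (χ.ringHomComp φ)⁻¹ := by
    conv_lhs => rw [← Nat.div_add_mod l 4, hl, pow_add, pow_mul, h4, one_pow, one_mul, h3]
  rw [hpow] at hfrob
  have hsh := gaussSum_mulShift (χ.ringHomComp φ)⁻¹ ψ hlu.unit
  rw [hlu.unit_spec, ← AddChar.pow_mulShift, ← hfrob] at hsh
  have hcard := gaussSum_mul_gaussSum_eq_card h1 hψ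
  have hneg := mul_gaussSum_inv_eq_gaussSum (χ.ringHomComp φ)⁻¹ ψ
  have hl4 : (χ.ringHomComp φ) l * (χ.ringHomComp φ)⁻¹ l = 1 := by
    rw [← MulChar.mul_apply, mul_inv_cancel, MulChar.one_apply hlu]
  have hm4 : (χ.ringHomComp φ) (-1) * (χ.ringHomComp φ)⁻¹ (-1) = 1 := by
    rw [← MulChar.mul_apply, mul_inv_cancel, MulChar.one_apply isUnit_one.neg]
  have hmm : (χ.ringHomComp φ)⁻¹ (-1) = (χ.ringHomComp φ) (-1) := by
    have : (χ.ringHomComp φ) (-1) * (χ.ringHomComp φ) (-1) = 1 := by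
      rw [← map_mul, neg_mul_neg, one_mul, map_one]
    linear_combination (χ.ringHomComp φ) (-1) * hm4 - (χ.ringHomComp φ)⁻¹ (-1) * this
  have hnl : φ (χ (-l)) = (χ.ringHomComp φ) (-1) * (χ.ringHomComp φ) l := by
    rw [← map_mul, neg_one_mul, MulChar.ringHomComp_apply]
  rw [ZMod.card] at hcard
  rw [← hg4, ← pow_mul, show 4 * ((l + 1) / 4) = l + 1 by omega, hnl, hpe, map_natCast φ, ← hcard,
    pow_succ]
  linear_combination (-gaussSum (χ.ringHomComp φ) ψ ^ l * gaussSum (χ.ringHomComp φ) ψ) * hl4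
    + (χ.ringHomComp φ) l * gaussSum (χ.ringHomComp φ) ψ * hsh
    - (χ.ringHomComp φ) l * gaussSum (χ.ringHomComp φ) ψ * hneg
    + (χ.ringHomComp φ) l * gaussSum (χ.ringHomComp φ) ψ *
      gaussSum (χ.ringHomComp φ)⁻¹ ψ⁻¹ * hmm

end GaussSum

/-- An algebraically closed field of characteristic `l` together with a map from the Gaussian
integers and a primitive additive character modulo `p`. -/
lemma exists_hom_and_addChar (p l : ℕ) [Fact p.Prime] [Fact l.Prime] (hpl : p ≠ l) :
    ∃ (_ : GaussianInt →+* AlgebraicClosure (ZMod l))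
      (ψ : AddChar (ZMod p) (AlgebraicClosure (ZMod l))), ψ.IsPrimitive := by
  have : CharP (AlgebraicClosure (ZMod l)) l := charP_of_injective_algebraMap
    (algebraMap (ZMod l) (AlgebraicClosure (ZMod l))).injective l
  obtain ⟨r, hr⟩ := IsAlgClosed.exists_pow_nat_eq (-1 : AlgebraicClosure (ZMod l)) two_pos
  have : NeZero (p : AlgebraicClosure (ZMod l)) := ⟨by
    rw [Ne, CharP.cast_eq_zero_iff (AlgebraicClosure (ZMod l)) l]
    exact fun hd => hpl ((Nat.prime_dvd_prime_iff_eq Fact.out Fact.out).1 hd).symm⟩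
  obtain ⟨ζ, hζ⟩ := HasEnoughRootsOfUnity.exists_primitiveRoot (AlgebraicClosure (ZMod l)) p
  refine ⟨Zsqrtd.lift ⟨r, by push_cast; rw [← hr, sq]⟩, _,
    AddChar.zmodChar_primitive_of_primitive_root p hζ⟩

/-! ### Quartic reciprocity -/

lemma symbol_intCast_eq {p : ℕ} [Fact p.Prime] {π : GaussianInt} {f : GaussianInt →+* ZMod p}
    {χ : MulChar (ZMod p) GaussianInt} (hp : p % 4 = 1) (hN : π.norm = p)
    (hf : ∀ α, f α = 0 ↔ π ∣ α) (h : IsQuarticLift f χ) (n : ℤ) :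
    symbol n π = toComplex (χ n) := by
  have hπ := prime_of_norm_prime Fact.out hN
  have ho : Odd π.norm := by rw [hN, Int.odd_iff]; omega
  rw [symbol_prime hπ, primeSymbol_eq hπ ho (h.isValue n)]
  rw [← hf, map_sub, map_pow, map_intCast, h.map_apply, symbolExponent, hN, Int.natAbs_natCast,
    sub_self]

lemma reciprocity_split {p : ℕ} [Fact p.Prime] {π : GaussianInt} (hp : p % 4 = 1)
    (hN : π.norm = p) (hi : Even π.im) {l : ℕ} [Fact l.Prime] (hl : l % 4 = 1) (hpl : p ≠ l) :
    symbol (l : ℤ) π = symbol π (l : ℤ) := by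
  obtain ⟨f, hf⟩ := exists_residue_hom hN
  obtain ⟨χ, hχ⟩ := exists_isQuarticLift hp hN hf
  obtain ⟨φ, ψ, hψ⟩ := exists_hom_and_addChar p l hpl
  have : CharP (AlgebraicClosure (ZMod l)) l := charP_of_injective_algebraMap
    (algebraMap (ZMod l) (AlgebraicClosure (ZMod l))).injective l
  -- Of the two conjugate primes above `l`, the one killed by `φ` is taken, so that symbols modulo
  -- `ρ` can be read off in the field.
  obtain ⟨ρ, hρ, hρN, hρe, hρφ⟩ : ∃ ρ : GaussianInt, Prime ρ ∧ ρ.norm = l ∧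
      (l : GaussianInt) = ρ * star ρ ∧ φ ρ = 0 := by
    obtain ⟨ρ, hρ, hρN, hρe⟩ := exists_split_prime (Fact.out : l.Prime) hl
    have h0 : φ ρ * φ (star ρ) = 0 := by
      rw [← map_mul, ← hρe, map_natCast, CharP.cast_eq_zero]
    rcases mul_eq_zero.1 h0 with h | h
    · exact ⟨ρ, hρ, hρN, hρe, h⟩
    · exact ⟨star ρ, prime_star hρ, by rw [Zsqrtd.norm_conj, hρN],
        by rw [star_star, mul_comm, hρe], h⟩
  have hlo : Odd l := by rw [Nat.odd_iff]; omega
  have ho : Odd ρ.norm := by rw [hρN, Int.odd_iff]; omega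
  have he : symbolExponent ρ = (l - 1) / 4 := by rw [symbolExponent, hρN, Int.natAbs_natCast]
  have hval : ∀ α, ∃ z, IsValue z ∧ symbol α ρ = toComplex z ∧ φ α ^ ((l - 1) / 4) = φ z := by
    intro α
    obtain ⟨z, hz, hd⟩ := exists_value hρ ho α
    refine ⟨z, hz, by rw [symbol_prime hρ, primeSymbol_eq hρ ho hz hd], ?_⟩
    obtain ⟨c, hc⟩ := hd
    have := congrArg φ hc
    rw [map_mul, hρφ, zero_mul, map_sub, map_pow, sub_eq_zero, he] at this
    exact this
  obtain ⟨z, hz, hsz, hφz⟩ := hval π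
  obtain ⟨w, hw, hsw, hφw⟩ := hval (star π)
  have hfrob := hχ.frobenius_split φ hp hN hf hi hl hpl hψ
  rw [map_mul, mul_pow, map_pow, ← pow_mul, mul_comm 3, pow_mul, hφz, hφw, ← map_pow, ← map_mul,
    ← map_mul] at hfrob
  -- Here `z = (π/ρ)` and `w = (star π/ρ)`. The relation gives `χ(l) = z star w`, which is
  -- `(π/ρ)(π/star ρ) = (π/l)`.
  have hone : χ l * (z ^ 3 * w) = 1 :=
    ((hχ.isValue _).mul ((hz.pow 3).mul hw)).eq_of_map_eq_of_odd φ hlo .one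
      (by rw [hfrob, map_one])
  have hz0 : z ≠ 0 := by rintro rfl; simp at hone
  have hw0 : w ≠ 0 := by rintro rfl; simp at hone
  have hz4 := hz.pow_four hz0
  have hws := hw.mul_star hw0
  have hfin : χ l = z * star w := by
    linear_combination z * star w * hone - χ l * w * star w * hz4 - χ l * hws
  rw [symbol_intCast_eq hp hN hf hχ, Int.cast_natCast, Int.cast_natCast, hρe, symbol_split ho,
    hsz, hsw, hfin, map_mul, toComplex_star]
  rfl

lemma reciprocity_inert {p : ℕ} [Fact p.Prime] {π : GaussianInt} (hp : p % 4 = 1)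
    (hN : π.norm = p) (hi : Even π.im) {l : ℕ} [Fact l.Prime] (hl : l % 4 = 3) (hpl : p ≠ l) :
    symbol (-l : ℤ) π = symbol π (-l : ℤ) := by
  obtain ⟨f, hf⟩ := exists_residue_hom hN
  obtain ⟨χ, hχ⟩ := exists_isQuarticLift hp hN hf
  obtain ⟨φ, ψ, hψ⟩ := exists_hom_and_addChar p l hpl
  have : CharP (AlgebraicClosure (ZMod l)) l := charP_of_injective_algebraMap
    (algebraMap (ZMod l) (AlgebraicClosure (ZMod l))).injective l
  have hl' := prime_of_nat_prime_of_mod_four_eq_three l hl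
  have hφl : φ (l : GaussianInt) = 0 := by rw [map_natCast, CharP.cast_eq_zero]
  have hfrob := hχ.frobenius_inert φ hp hN hf hi hl hpl hψ
  have hconj : φ π ^ l = φ (star π) := by
    obtain ⟨c, hc⟩ := dvd_pow_sub_star (Fact.out : l.Prime) hl π
    have := congrArg φ hc
    rwa [map_mul, hφl, zero_mul, map_sub, map_pow, sub_eq_zero] at this
  have hp0 : φ π ≠ 0 := by
    intro h0
    have hpe : π * star π = p := by rw [← Zsqrtd.norm_eq_mul_conj, hN]; simp
    have := congrArg φ hpe
    rw [map_mul, h0, zero_mul, map_natCast, eq_comm,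
      CharP.cast_eq_zero_iff (AlgebraicClosure (ZMod l)) l] at this
    exact hpl ((Nat.prime_dvd_prime_iff_eq Fact.out Fact.out).1 this).symm
  rw [map_mul, map_mul, map_pow, ← hconj, ← pow_add, ← pow_mul] at hfrob
  -- Since `star π` becomes `π^l`, the Frobenius relation reads `π^((l+3)(l+1)/4) = χ(-l) π^(l+1)`;
  -- cancel `π^(l+1)`.
  have hkey : φ π ^ ((l - 1) * ((l + 1) / 4)) = φ (χ (-l)) := by
    apply mul_right_cancel₀ (pow_ne_zero (l + 1) hp0)
    rw [← pow_add, pow_succ' (φ π) l, ← hfrob]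
    congr 1
    obtain ⟨k, rfl⟩ : ∃ k, l = 4 * k + 3 := ⟨l / 4, by omega⟩
    rw [show 4 * k + 3 - 1 = 4 * k + 2 by omega, show (4 * k + 3 + 1) / 4 = k + 1 by omega]
    ring
  rw [symbol_intCast_eq hp hN hf hχ, Int.cast_neg, Int.cast_neg, Int.cast_natCast,
    Int.cast_natCast, symbol_neg_right]
  refine (symbol_inert Fact.out hl (hχ.isValue _) (dvd_of_map_eq_zero φ hl' hφl ?_)).symm
  rw [map_sub, map_pow, hkey, sub_self]

lemma reciprocity_prime {p : ℕ} [Fact p.Prime] {π : GaussianInt} (hp : p % 4 = 1)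
    (hN : π.norm = p) (hi : Even π.im) {n : ℤ} (hn : n % 4 = 1) :
    symbol n π = symbol π n := by
  have ho : Odd π.norm := by rw [hN, Int.odd_iff]; omega
  refine induction_one_mod_four (P := fun n : ℤ => symbol n π = symbol π n) ?_ ?_ ?_ ?_ hn
  · rw [Int.cast_one, symbol_one_left ho, symbol_of_isUnit isUnit_one]
  · intro a b ha hb iha ihb
    rw [Int.cast_mul, symbol_mul_left ho, iha, ihb, symbol_mul_right
      (intCast_ne_zero_of_mod_four ha) (intCast_ne_zero_of_mod_four hb)]
  · intro l hl h1
    have : Fact l.Prime := ⟨hl⟩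
    -- If `p = l`, both symbols vanish.
    by_cases hpl : p = l
    · subst hpl
      have hd : π ∣ ((p : ℤ) : GaussianInt) := ⟨star π, by
        rw [← Zsqrtd.norm_eq_mul_conj, hN]⟩
      have hnc : ¬ IsCoprime π ((p : ℤ) : GaussianInt) := fun hc =>
        (prime_of_norm_prime Fact.out hN).not_isUnit (hc.isUnit_of_dvd' dvd_rfl hd)
      rw [symbol_eq_zero ho (fun hc => hnc hc.symm),
        symbol_eq_zero (odd_norm_intCast (by rw [Int.odd_iff]; omega)) hnc]
    · exact reciprocity_split hp hN hi h1 hpl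
  · intro l hl h3
    have : Fact l.Prime := ⟨hl⟩
    exact reciprocity_inert hp hN hi h3 (by rintro rfl; omega)

/-- Quartic reciprocity between a rational integer and a Gaussian integer. -/
theorem reciprocity {n : ℤ} (hn : n % 4 = 1) {γ : GaussianInt} (hγ : Odd γ.norm)
    (hi : Even γ.im) : symbol n γ = symbol γ n := by
  have hno : Odd n := by rw [Int.odd_iff]; omega
  have hn' := odd_norm_intCast hno
  have hneg : ∀ α, symbol (-α) n = symbol α n := by
    intro α
    have h1 := symbol_intCast_intCast hno (n := -1) isCoprime_one_left.neg_left
    rw [Int.cast_neg, Int.cast_one] at h1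
    rw [← neg_one_mul, symbol_mul_left hn', h1, one_mul]
  -- The prime factors of `γ` need not have even imaginary part. Each is normalized by a unit, and
  -- the accumulated unit `u` is identified only at the end: as `γ` and `uγ` both have even
  -- imaginary part, `u = ±1`, and `-1` has symbol 1 modulo `n`.
  have key : ∃ u, IsUnit u ∧ Even (u * γ).im ∧ symbol n γ = symbol (u * γ) n := by
    refine induction_on_odd_norm
      (P := fun γ => ∃ u, IsUnit u ∧ Even (u * γ).im ∧ symbol n γ = symbol (u * γ) n)
      ?_ ?_ ?_ hγ
    · intro u hu
      obtain ⟨v, hv⟩ := hu.exists_left_inv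
      refine ⟨v, IsUnit.of_mul_eq_one _ hv, by rw [hv]; decide, ?_⟩
      rw [hv, symbol_of_isUnit hu, symbol_one_left hn']
    · rintro π γ hπ ho hγ ⟨u, hu, hui, h1⟩ ⟨v, hv, hvi, h2⟩
      refine ⟨u * v, hu.mul hv, ?_, ?_⟩
      · rw [show u * v * (π * γ) = (u * π) * (v * γ) by ring, Zsqrtd.im_mul]
        exact (hvi.mul_left _).add (hui.mul_right _)
      · rw [show u * v * (π * γ) = (u * π) * (v * γ) by ring, symbol_mul_left hn', ← h1, ← h2,
          symbol_mul_right (ne_zero_of_odd_norm ho) (ne_zero_of_odd_norm hγ)]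
    · intro π hπ ho
      rcases prime_cases hπ ho with ⟨p, hp, h3, has⟩ | ⟨p, hp, h1, hN⟩
      · have hsym := symbol_associated has n
        obtain ⟨u, hu⟩ := has
        rw [mul_comm] at hu
        refine ⟨u, u.isUnit, by rw [hu]; simp, ?_⟩
        rw [hsym, hu]
        have hpo : Odd (p : ℤ) := by rw [Int.odd_iff]; omega
        have hp' := odd_norm_intCast hpo
        by_cases hc : IsCoprime n p
        · have e1 := symbol_intCast_intCast hpo hc
          have e2 := symbol_intCast_intCast hno hc.symm
          rw [Int.cast_natCast] at e1 e2
          rw [e1, e2]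
        · have hc' : ¬ IsCoprime (n : GaussianInt) ((p : ℤ) : GaussianInt) :=
            fun hcc => hc (isCoprime_of_intCast hcc)
          have e1 := symbol_eq_zero hp' hc'
          have e2 := symbol_eq_zero hn' (fun h => hc' h.symm)
          rw [Int.cast_natCast] at e1 e2
          rw [e1, e2]
      · have : Fact p.Prime := ⟨hp⟩
        have hodd := odd_norm_iff.1 ho
        rcases Int.even_or_odd π.im with hi | hi
        · exact ⟨1, isUnit_one, by rwa [one_mul], by rw [one_mul, reciprocity_prime h1 hN hi hn]⟩
        · have hu : IsUnit (⟨0, 1⟩ : GaussianInt) := by rw [isUnit_iff_norm]; decide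
          have hi' : Even ((⟨0, 1⟩ : GaussianInt) * π).im := by
            simp only [Zsqrtd.im_mul]
            rw [zero_mul, one_mul, zero_add]
            rwa [add_comm, Int.odd_add, iff_true_left hi] at hodd
          have hN' : ((⟨0, 1⟩ : GaussianInt) * π).norm = p := by
            rw [Zsqrtd.norm_mul, hN, isUnit_iff_norm.1 hu, one_mul]
          refine ⟨_, hu, hi', ?_⟩
          rw [← reciprocity_prime h1 hN' hi' hn]
          exact symbol_associated (associated_unit_mul_right π _ hu) _
  obtain ⟨u, hu, hui, h⟩ := key
  have hodd := odd_norm_iff.1 hγ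
  rw [Int.odd_add, iff_true_right hi, ← Int.not_even_iff_odd] at hodd
  rw [h]
  rcases cases_of_isUnit hu with rfl | rfl | rfl | rfl
  · rw [one_mul]
  · rw [neg_one_mul, hneg]
  all_goals
    simp [hodd] at hui

/-! ### Symbols of the integers attached to `p = c² + d²` -/

lemma symbol_I_intCast (w : ℤ) :
    symbol ⟨0, 1⟩ ((4 * w + 1 : ℤ) : GaussianInt) = Complex.I ^ (2 * w) := by
  have ho := odd_norm_intCast (m := 4 * w + 1) (by rw [Int.odd_iff]; omega)
  rw [symbol_I_left ho, ← zpow_natCast]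
  apply I_zpow_of_modEq
  have h1 := four_mul_symbolExponent ho
  have h2 := abs_natCast_norm ((4 * w + 1 : ℤ) : GaussianInt)
  have h3 := norm_mod_four ho
  rw [Zsqrtd.norm_intCast] at h1 h2 h3
  have h4 : (symbolExponent ((4 * w + 1 : ℤ) : GaussianInt) : ℤ) = 4 * (w * w) + 2 * w := by
    have h5 : (4 * w + 1) * (4 * w + 1) = 4 * (4 * (w * w) + 2 * w) + 1 := by ring
    rw [h5] at h1 h2
    omega
  rw [h4]
  exact (Int.modEq_iff_dvd.2 ⟨-(w * w), by ring⟩)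

lemma symbol_one_add_I_intCast (w : ℤ) :
    symbol ⟨1, 1⟩ ((4 * w + 1 : ℤ) : GaussianInt) = Complex.I ^ w := by
  rw [symbol_one_add_I_left (by omega)]
  congr 1
  omega

lemma odd_norm_four_mul_add_one (w : ℤ) : Odd ((4 * w + 1 : ℤ) : GaussianInt).norm :=
  odd_norm_intCast (by rw [Int.odd_iff]; omega)

lemma symbol_of_eq_mul {γ g : GaussianInt} {t : ℕ} (h : γ = ⟨1, 1⟩ * ⟨0, 1⟩ ^ t * g)
    (hg : Odd g.norm) (hi : Even g.im) (w : ℤ) :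
    symbol γ ((4 * w + 1 : ℤ) : GaussianInt) =
      Complex.I ^ (w + 2 * w * t) * symbol ((4 * w + 1 : ℤ) : GaussianInt) g := by
  have ho := odd_norm_four_mul_add_one w
  rw [h, symbol_mul_left ho, symbol_mul_left ho, symbol_pow_left ho, symbol_I_intCast,
    symbol_one_add_I_intCast, reciprocity (by omega) hg hi, zpow_add₀ Complex.I_ne_zero, zpow_mul _ (2 * w),
    zpow_natCast]

lemma isCoprime_of_prime_eq {p : ℕ} (hp : p.Prime) {a b e : ℤ} (h : (p : ℤ) = a ^ 2 + e * b ^ 2) :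
    IsCoprime a b := by
  have hsq := (Nat.prime_iff_prime_int.1 hp).squarefree
  refine isCoprime_of_prime_dvd ?_ ?_
  · rintro ⟨rfl, rfl⟩
    have := hp.ne_zero
    simp at h
    omega
  · rintro l hl ⟨u, rfl⟩ ⟨v, rfl⟩
    exact hl.not_isUnit (hsq l ⟨u ^ 2 + e * v ^ 2, by rw [h]; ring⟩)

lemma intCast_pow_of_symbol_eq {p : ℕ} [Fact p.Prime] {π : GaussianInt}
    {f : GaussianInt →+* ZMod p} (hp : p % 4 = 1) (hN : π.norm = p) (hf : ∀ α, f α = 0 ↔ π ∣ α)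
    {n e : ℤ} (h : symbol n π = Complex.I ^ e) :
    (n : ZMod p) ^ ((p - 1) / 4) = f ⟨0, 1⟩ ^ e := by
  obtain ⟨χ, hχ⟩ := exists_isQuarticLift hp hN hf
  have h4 : f ⟨0, 1⟩ ^ 4 = 1 := by
    rw [← map_pow, show (⟨0, 1⟩ : GaussianInt) ^ 4 = 1 by decide, map_one]
  have h0 : f ⟨0, 1⟩ ≠ 0 := by
    intro h0
    rw [h0] at h4
    norm_num at h4
  have hr : ((e % 4).toNat : ℤ) = e % 4 := Int.toNat_of_nonneg (by omega)
  have h1 : χ n = ⟨0, 1⟩ ^ (e % 4).toNat := by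
    apply toComplex_injective
    rw [← symbol_intCast_eq hp hN hf hχ, h, map_pow, toComplex_I, ← zpow_natCast, hr]
    exact I_zpow_of_modEq (Int.mod_modEq _ _).symm
  rw [← hχ.map_apply, h1, map_pow, ← zpow_natCast, hr]
  conv_rhs => rw [← Int.emod_add_mul_ediv e 4, zpow_add₀ h0, zpow_mul]
  rw [show f ⟨0, 1⟩ ^ (4 : ℤ) = 1 from (zpow_ofNat _ 4).trans h4, one_zpow, mul_one]

lemma norm_mk (a b : ℤ) : (⟨a, b⟩ : GaussianInt).norm = a ^ 2 + b ^ 2 := by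
  simp [Zsqrtd.norm]; ring

/-- The symbol of `c` modulo the primary prime `c + di`. -/
lemma symbol_re {p : ℕ} (hp : p.Prime) (hp8 : p % 8 = 1) {m δ : ℤ}
    (h : (p : ℤ) = (4 * m + 1) ^ 2 + (4 * δ) ^ 2) :
    symbol ((4 * m + 1 : ℤ) : GaussianInt) ⟨4 * m + 1, 4 * δ⟩ = Complex.I ^ (2 * m) := by
  have ho : Odd (⟨4 * m + 1, 4 * δ⟩ : GaussianInt).norm := by
    rw [norm_mk, ← h, Int.odd_iff]; omega
  have hc : IsCoprime (4 * m + 1) (4 * δ) := isCoprime_of_prime_eq hp (e := 1) (by rw [h]; ring)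
  have ho' := odd_norm_four_mul_add_one m
  rw [reciprocity (by omega) ho ⟨2 * δ, by ring⟩,
    symbol_congr ho' (β := ((4 * δ : ℤ) : GaussianInt) * ⟨0, 1⟩), symbol_mul_left ho',
    symbol_intCast_intCast (by rw [Int.odd_iff]; omega) hc.symm, symbol_I_intCast, one_mul]
  refine ⟨1, ?_⟩
  ext <;> simp

/-- The symbol of `c + d` modulo the primary prime `c + di`. -/
lemma symbol_re_add_im {p : ℕ} (hp : p.Prime) (hp8 : p % 8 = 1) {m δ : ℤ}
    (h : (p : ℤ) = (4 * m + 1) ^ 2 + (4 * δ) ^ 2) :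
    symbol ((4 * (m + δ) + 1 : ℤ) : GaussianInt) ⟨4 * m + 1, 4 * δ⟩ =
      Complex.I ^ (-(m + δ)) := by
  have ho : Odd (⟨4 * m + 1, 4 * δ⟩ : GaussianInt).norm := by
    rw [norm_mk, ← h, Int.odd_iff]; omega
  have hc : IsCoprime (4 * m + 1) (4 * δ) := isCoprime_of_prime_eq hp (e := 1) (by rw [h]; ring)
  have hc' : IsCoprime (4 * m + 1) (4 * (m + δ) + 1) := by
    rw [show 4 * (m + δ) + 1 = 4 * δ + (4 * m + 1) * 1 by ring]
    exact hc.add_mul_left_right 1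
  have ho' := odd_norm_four_mul_add_one (m + δ)
  have hodd : Odd (4 * (m + δ) + 1) := by rw [Int.odd_iff]; omega
  -- The symbols of `1 + i` and `1 - i` are inverse to each other because their product is that of
  -- the rational integer 2. The symbol of `1 - i` is what is needed, as `c + di ≡ c(1 - i)` modulo
  -- `c + d`.
  have h2 : symbol ⟨1, 1⟩ ((4 * (m + δ) + 1 : ℤ) : GaussianInt) *
      symbol ⟨1, -1⟩ ((4 * (m + δ) + 1 : ℤ) : GaussianInt) = 1 := by
    rw [← symbol_mul_left ho', show (⟨1, 1⟩ : GaussianInt) * ⟨1, -1⟩ = ((2 : ℤ) : GaussianInt) by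
      decide]
    exact symbol_intCast_intCast hodd ⟨-(2 * (m + δ)), 1, by ring⟩
  rw [symbol_one_add_I_intCast] at h2
  rw [reciprocity (by omega) ho ⟨2 * δ, by ring⟩,
    symbol_congr ho' (β := ((4 * m + 1 : ℤ) : GaussianInt) * ⟨1, -1⟩), symbol_mul_left ho',
    symbol_intCast_intCast hodd hc', one_mul, zpow_neg]
  · exact eq_inv_of_mul_eq_one_right h2
  · refine ⟨⟨0, 1⟩, ?_⟩
    ext <;> simp
    ring

lemma neg_one_pow_eq_I_zpow (n : ℕ) : (-1 : ℂ) ^ n = Complex.I ^ (2 * (n : ℤ)) := by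
  rw [zpow_mul, zpow_natCast, show Complex.I ^ (2 : ℤ) = -1 from (zpow_ofNat _ 2).trans Complex.I_sq]

/-- The square of the symbol of `y` modulo `g`, where `c + (x + d) i` is `g` up to a unit and a
factor `1 + i`, is the symbol of `y` modulo `c + d i`. -/
lemma symbol_sq_eq_symbol {π γ g : GaussianInt} {t : ℕ} {z a : ℤ}
    (h : γ = ⟨1, 1⟩ * ⟨0, 1⟩ ^ t * g) (hg : Odd g.norm) (hi : Even g.im) (ho : Odd π.norm)
    (hπi : Even π.im) (hc : IsCoprime a (4 * z + 1))
    (hd : ((4 * z + 1 : ℤ) : GaussianInt) ∣ γ ^ 2 - ⟨0, 1⟩ * ((2 * a : ℤ) * π)) :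
    symbol ((4 * z + 1 : ℤ) : GaussianInt) g ^ 2 = symbol ((4 * z + 1 : ℤ) : GaussianInt) π := by
  have ho' := odd_norm_four_mul_add_one z
  have hodd : Odd (4 * z + 1) := by rw [Int.odd_iff]; omega
  have h1 := symbol_congr ho' hd
  have hc' : IsCoprime (2 * a) (4 * z + 1) := IsCoprime.mul_left ⟨-(2 * z), 1, by ring⟩ hc
  -- The squared supplementary factor reduces to `I ^ (2 * z)`, the same as the symbol of `i` on the
  -- other side, and both cancel.
  rw [symbol_pow_left ho', symbol_of_eq_mul h hg hi, symbol_mul_left ho', symbol_mul_left ho',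
    symbol_intCast_intCast hodd hc', one_mul, symbol_I_intCast, ← reciprocity (by omega) ho hπi,
    mul_pow, ← zpow_natCast, ← zpow_mul,
    I_zpow_of_modEq (b := 2 * z) (Int.modEq_iff_dvd.2 ⟨-(z * t), by push_cast; ring⟩)] at h1
  exact mul_left_cancel₀ (zpow_ne_zero _ Complex.I_ne_zero) h1

lemma symbol_intCast_of_natAbs_eq {a b : ℤ} (h : a = b ∨ a = -b) (α : GaussianInt) :
    symbol α (a : GaussianInt) = symbol α (b : GaussianInt) := by
  rcases h with rfl | rfl
  · rfl
  · rw [Int.cast_neg, symbol_neg_right]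

/-! ### Comparing the symbols of `γ` modulo `q`, `x`, `x + d` and `y` -/

/-- The relation between the exponents of the symbols of `x` and `y` modulo `c + d i` and that of
`c + (x + d) i` modulo `q`, for `c = 4 * m + 1`, `d = 4 * δ`, `± x = 4 * w + 1`,
`± (x + d) = 4 * v + 1`, `y = ± 2 ^ s * (4 * z + 1)` and `± q = 4 * n + 1`. -/
lemma exponent_relation {p : ℕ} (hp : p.Prime) (hp8 : p % 8 = 1)
    {q m δ x y w v z n k ε τ σ : ℤ} {s t : ℕ} {g : GaussianInt}
    (hcd : (p : ℤ) = (4 * m + 1) ^ 2 + (4 * δ) ^ 2) (hxy : (p : ℤ) = x ^ 2 + 2 * q * y ^ 2)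
    (hε : ε = 1 ∨ ε = -1) (hτ : τ = 1 ∨ τ = -1) (hσ : σ = 1 ∨ σ = -1)
    (hX : 4 * w + 1 = ε * x) (hS : 4 * v + 1 = ε * (x + 4 * δ)) (hY : y = τ * 2 ^ s * (4 * z + 1))
    (hQ : 4 * n + 1 = σ * q) (hgcd : IsCoprime (4 * m + 1) (x + 4 * δ)) (hpx : ¬ (p : ℤ) ∣ x)
    (hpy : ¬ (p : ℤ) ∣ y)
    (hγ : (⟨4 * m + 1, x + 4 * δ⟩ : GaussianInt) = ⟨1, 1⟩ * ⟨0, 1⟩ ^ t * g) (hg : Odd g.norm)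
    (hi : Even g.im) (hN : g.norm = x * (x + 4 * δ) + q * y ^ 2)
    (hk : symbol ⟨4 * m + 1, x + 4 * δ⟩ q = Complex.I ^ k) :
    ∃ eX eY : ℤ,
      symbol ((4 * w + 1 : ℤ) : GaussianInt) ⟨4 * m + 1, 4 * δ⟩ = Complex.I ^ eX ∧
      symbol ((4 * z + 1 : ℤ) : GaussianInt) ⟨4 * m + 1, 4 * δ⟩ = Complex.I ^ eY ∧
      k - n - 2 * n * t - (1 - σ) * symbolExponent g ≡
        eX - eY + (2 - 2 * s) * symbolExponent g - w - 2 * w * t - v - 2 * v * t [ZMOD 4] := by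
  set π : GaussianInt := ⟨4 * m + 1, 4 * δ⟩ with hπ
  set γ : GaussianInt := ⟨4 * m + 1, x + 4 * δ⟩ with hγ'
  have hN0 : π.norm = p := by rw [hπ, norm_mk, hcd]
  have hπp : Prime π := prime_of_norm_prime hp hN0
  have ho : Odd π.norm := by rw [hN0, Int.odd_iff]; omega
  have hπi : Even π.im := ⟨2 * δ, by rw [hπ]; ring⟩
  have hcop : ∀ a : ℤ, ¬ (p : ℤ) ∣ a → IsCoprime (a : GaussianInt) π := by
    intro a ha
    have h1 : IsCoprime (a : GaussianInt) ((p : ℤ) : GaussianInt) := intCast_isCoprime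
      ((Nat.prime_iff_prime_int.1 hp).irreducible.coprime_iff_not_dvd.2 ha).symm
    rw [show ((p : ℤ) : GaussianInt) = π * star π by rw [← Zsqrtd.norm_eq_mul_conj, hN0]] at h1
    exact h1.of_mul_right_left
  have hx0 : symbol ((4 * w + 1 : ℤ) : GaussianInt) π ≠ 0 := symbol_ne_zero ho (hcop _ (by
    rw [hX]; rcases hε with rfl | rfl <;> simpa using hpx))
  have hy0 : symbol ((4 * z + 1 : ℤ) : GaussianInt) π ≠ 0 := symbol_ne_zero ho (hcop _ (by
    rw [hY] at hpy; exact fun h => hpy (h.mul_left _)))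
  obtain ⟨eX, heX⟩ := exists_symbol_eq_zpow ho hx0
  obtain ⟨eY, heY⟩ := exists_symbol_eq_zpow ho hy0
  -- the symbol modulo `q`
  have hQs : symbol γ ((4 * n + 1 : ℤ) : GaussianInt) = Complex.I ^ k := by
    rw [← hk]
    exact symbol_intCast_of_natAbs_eq (by rw [hQ]; rcases hσ with rfl | rfl <;> simp) _
  rw [symbol_of_eq_mul hγ hg hi] at hQs
  -- the symbol modulo `x`
  have hXs : symbol γ ((4 * w + 1 : ℤ) : GaussianInt) = Complex.I ^ eX := by
    rw [← heX, reciprocity (by omega) ho hπi]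
    refine symbol_congr (odd_norm_four_mul_add_one w) ⟨ε * ⟨0, 1⟩, ?_⟩
    rw [hX]
    have : ε * ε = 1 := by rcases hε with rfl | rfl <;> norm_num
    ext
    · simp [hγ', hπ]
    · simp [hγ', hπ]
      linear_combination -x * this
  rw [symbol_of_eq_mul hγ hg hi] at hXs
  -- the symbol modulo `x + d`
  have hSs : symbol γ ((4 * v + 1 : ℤ) : GaussianInt) = 1 := by
    rw [← symbol_intCast_intCast (m := 4 * v + 1) (n := 4 * m + 1) (by rw [Int.odd_iff]; omega)
      (by rw [hS]; exact IsCoprime.mul_right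
            (by
              rcases hε with rfl | rfl
              · exact isCoprime_one_right
              · exact isCoprime_one_right.neg_right) hgcd)]
    refine symbol_congr (odd_norm_four_mul_add_one v) ⟨ε * ⟨0, 1⟩, ?_⟩
    rw [hS]
    have : ε * ε = 1 := by rcases hε with rfl | rfl <;> norm_num
    ext
    · simp [hγ']
    · simp [hγ']
      linear_combination -(x + 4 * δ) * this
  rw [symbol_of_eq_mul hγ hg hi] at hSs
  -- the symbol modulo the odd part of `y`
  have hYs : symbol ((4 * z + 1 : ℤ) : GaussianInt) g ^ 2 = Complex.I ^ eY := by
    rw [← heY]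
    refine symbol_sq_eq_symbol (a := x + 4 * δ) hγ hg hi ho hπi ?_ ?_
    -- A common prime of `x + d` and the odd part of `y` divides `c² = (x - d)(x + d) + 2qy²`,
    -- against the coprimality of `c` and `x + d`.
    · refine isCoprime_of_prime_dvd (fun h => by omega) fun l hl h1 h2 => ?_
      have h3 : l ∣ (4 * m + 1) ^ 2 := by
        obtain ⟨a, ha⟩ := h1
        obtain ⟨b, hb⟩ := h2
        refine ⟨(x - 4 * δ) * a + 2 * q * y * (τ * 2 ^ s) * b, ?_⟩
        rw [hb] at hY
        linear_combination hxy - hcd + (x - 4 * δ) * ha + 2 * q * y * hY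
      exact hl.not_isUnit (hgcd.isUnit_of_dvd' (hl.dvd_of_dvd_pow h3) h1)
    · obtain ⟨b, hb⟩ : ∃ b, y = b * (4 * z + 1) := ⟨_, hY⟩
      refine ⟨((2 * q * y * b : ℤ) : GaussianInt), ?_⟩
      rw [← Int.cast_mul, sq]
      ext
      · simp [hγ', hπ]
        linear_combination hxy - hcd + 2 * q * y * hb
      · simp [hγ', hπ]
        ring
  have hYg : symbol (y : GaussianInt) g ^ 2 = symbol (-1) g ^ s * Complex.I ^ eY := by
    have h2 : (y : GaussianInt) ^ 2 = (2 ^ 2) ^ s * ((4 * z + 1 : ℤ) : GaussianInt) ^ 2 := by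
      have : τ ^ 2 = 1 := by rcases hτ with rfl | rfl <;> norm_num
      have h3 : y ^ 2 = (2 ^ 2) ^ s * (4 * z + 1) ^ 2 := by
        rw [hY, ← pow_mul, mul_comm 2 s, pow_mul]; linear_combination (2 ^ s * (4 * z + 1)) ^ 2 * this
      exact_mod_cast congrArg (Int.cast : ℤ → GaussianInt) h3
    rw [← symbol_pow_left hg, h2, symbol_mul_left hg, symbol_pow_left hg, symbol_pow_left hg,
      symbol_pow_left hg, symbol_two_pow_two hg, hYs]
  -- This is the congruence `qy² ≡ -x(x + d)` modulo `g`; the sign `ε` occurs twice and drops out.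
  have hqg : symbol (q : GaussianInt) g * symbol (y : GaussianInt) g ^ 2 =
      symbol (-1) g * symbol ((4 * w + 1 : ℤ) : GaussianInt) g *
        symbol ((4 * v + 1 : ℤ) : GaussianInt) g := by
    rw [← symbol_pow_left hg, ← symbol_mul_left hg, ← symbol_mul_left hg, ← symbol_mul_left hg]
    refine symbol_congr hg ⟨star g, ?_⟩
    rw [← Zsqrtd.norm_eq_mul_conj, hN, hX, hS]
    have : ε * ε = 1 := by rcases hε with rfl | rfl <;> norm_num
    have h3 : q * y ^ 2 - -1 * (ε * x) * (ε * (x + 4 * δ)) = x * (x + 4 * δ) + q * y ^ 2 := by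
      linear_combination x * (x + 4 * δ) * this
    exact_mod_cast congrArg (Int.cast : ℤ → GaussianInt) h3
  have hneg : symbol (-1) g = Complex.I ^ (2 * (symbolExponent g : ℤ)) := by
    rw [symbol_neg_one_left hg, neg_one_pow_eq_I_zpow]
  have hQq : symbol ((4 * n + 1 : ℤ) : GaussianInt) g =
      Complex.I ^ ((1 - σ) * (symbolExponent g : ℤ)) * symbol (q : GaussianInt) g := by
    rw [hQ]
    rcases hσ with rfl | rfl
    · simp
    · rw [show (1 - -1 : ℤ) = 2 by norm_num, ← hneg, ← symbol_mul_left hg, Int.cast_mul,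
        Int.cast_neg, Int.cast_one]
  have nz : ∀ {a b : ℂ} {e : ℤ}, a * b = Complex.I ^ e → b ≠ 0 := by
    intro a b e h hb
    rw [hb, mul_zero] at h
    exact zpow_ne_zero _ Complex.I_ne_zero h.symm
  have hq0 : symbol (q : GaussianInt) g ≠ 0 := by
    intro h0
    rw [hQq, h0, mul_zero] at hQs
    exact nz hQs rfl
  obtain ⟨gX, hgX⟩ := exists_symbol_eq_zpow hg (nz hXs)
  obtain ⟨gS, hgS⟩ := exists_symbol_eq_zpow hg (nz (hSs.trans (zpow_zero Complex.I).symm))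
  obtain ⟨gq, hgq⟩ := exists_symbol_eq_zpow hg hq0
  rw [hQq, hgq, ← zpow_add₀ Complex.I_ne_zero, ← zpow_add₀ Complex.I_ne_zero] at hQs
  rw [hgX, ← zpow_add₀ Complex.I_ne_zero] at hXs
  rw [hgS, ← zpow_add₀ Complex.I_ne_zero, ← zpow_zero Complex.I] at hSs
  rw [hYg, hgq, hgX, hgS, hneg, ← zpow_natCast, ← zpow_mul, ← zpow_add₀ Complex.I_ne_zero,
    ← zpow_add₀ Complex.I_ne_zero, ← zpow_add₀ Complex.I_ne_zero,
    ← zpow_add₀ Complex.I_ne_zero] at hqg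
  refine ⟨eX, eY, heX, heY, ?_⟩
  obtain ⟨a1, h1⟩ := (modEq_of_I_zpow hQs).dvd
  obtain ⟨a2, h2⟩ := (modEq_of_I_zpow hXs).dvd
  obtain ⟨a3, h3⟩ := (modEq_of_I_zpow hSs).dvd
  obtain ⟨a4, h4⟩ := (modEq_of_I_zpow hqg).dvd
  rw [Int.modEq_iff_dvd]
  exact ⟨-a1 + a2 + a3 + a4, by linear_combination -h1 + h2 + h3 + h4⟩

/-! ### Passage to residues modulo `p` -/

/-- The power of `-q` in terms of the exponents of the symbols of `x` and `y` modulo `c + di`. -/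
lemma neg_pow_eq {p : ℕ} [Fact p.Prime] {q m δ x y w z ε τ eX eY M : ℤ} {s : ℕ}
    (hM : (p : ℤ) = 8 * M + 1)
    (hcd : (p : ℤ) = (4 * m + 1) ^ 2 + (4 * δ) ^ 2) (hxy : (p : ℤ) = x ^ 2 + 2 * q * y ^ 2)
    (hε : ε = 1 ∨ ε = -1) (hτ : τ = 1 ∨ τ = -1) (hX : 4 * w + 1 = ε * x)
    (hY : y = τ * 2 ^ s * (4 * z + 1)) {ι : ZMod p}
    (hι : ι = ((4 * δ : ℤ) : ZMod p) / ((4 * m + 1 : ℤ) : ZMod p))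
    (heX : symbol ((4 * w + 1 : ℤ) : GaussianInt) ⟨4 * m + 1, 4 * δ⟩ = Complex.I ^ eX)
    (heY : symbol ((4 * z + 1 : ℤ) : GaussianInt) ⟨4 * m + 1, 4 * δ⟩ = Complex.I ^ eY) :
    ι ^ 2 = -1 ∧ ((-q : ℤ) : ZMod p) ^ ((p - 1) / 8) =
      ι ^ (eX - eY + 2 * m + M + (m + δ) + s * (2 * (m + δ) + 4 * m + 2 * M)) := by
  have hp : p.Prime := Fact.out
  have hp8 : p % 8 = 1 := by omega
  have hN0 : (⟨4 * m + 1, 4 * δ⟩ : GaussianInt).norm = p := by rw [norm_mk, hcd]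
  obtain ⟨f, hf⟩ := exists_residue_hom hN0
  have hC := symbol_re hp hp8 hcd
  have hCD := symbol_re_add_im hp hp8 hcd
  replace heX := intCast_pow_of_symbol_eq (by omega) hN0 hf heX
  replace heY := intCast_pow_of_symbol_eq (by omega) hN0 hf heY
  replace hC := intCast_pow_of_symbol_eq (by omega) hN0 hf hC
  replace hCD := intCast_pow_of_symbol_eq (by omega) hN0 hf hCD
  have hfI : f ⟨0, 1⟩ ^ 2 = -1 := by
    rw [← map_pow, show (⟨0, 1⟩ : GaussianInt) ^ 2 = -1 by decide, map_neg, map_one]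
  have hf0 : f ⟨0, 1⟩ ≠ 0 := by
    intro h0
    rw [h0] at hfI
    norm_num at hfI
  have hπ0 : ((4 * m + 1 : ℤ) : ZMod p) + f ⟨0, 1⟩ * ((4 * δ : ℤ) : ZMod p) = 0 := by
    have h1 := (hf ⟨4 * m + 1, 4 * δ⟩).2 dvd_rfl
    rw [eq_add_mul_I ⟨4 * m + 1, 4 * δ⟩, map_add, map_mul, map_intCast, map_intCast] at h1
    linear_combination h1
  -- From `c + f(i)d = 0` and `f(i)² = -1`, the image of `i` is exactly `d/c`.
  have hd : ((4 * δ : ℤ) : ZMod p) = f ⟨0, 1⟩ * ((4 * m + 1 : ℤ) : ZMod p) := by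
    linear_combination ((4 * δ : ℤ) : ZMod p) * hfI - f ⟨0, 1⟩ * hπ0
  have hp1 : (p - 1) / 4 = 2 * ((p - 1) / 8) := by omega
  have hMn : (((p - 1) / 8 : ℕ) : ℤ) = M := by omega
  have hc0 : ((4 * m + 1 : ℤ) : ZMod p) ≠ 0 := by
    intro h0
    rw [h0, zero_pow (by have := hp.two_le; omega)] at hC
    exact zpow_ne_zero _ hf0 hC.symm
  have hιf : ι = f ⟨0, 1⟩ := by rw [hι, hd, mul_div_cancel_right₀ _ hc0]
  rw [← hιf] at hfI hf0 hd heX heY hC hCD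
  refine ⟨hfI, ?_⟩
  rw [hp1] at heX heY hC hCD
  set N := (p - 1) / 8
  have hτ2 : (τ : ZMod p) ^ 2 = 1 := by rcases hτ with rfl | rfl <;> simp
  have hX2 : ((4 * w + 1 : ℤ) : ZMod p) ^ 2 =
      ((-q : ℤ) : ZMod p) * 2 * ((2 ^ 2) ^ s * ((4 * z + 1 : ℤ) : ZMod p) ^ 2) := by
    have h1 : ((x ^ 2 + 2 * q * y ^ 2 : ℤ) : ZMod p) = 0 := by
      rw [← hxy, Int.cast_natCast, CharP.cast_eq_zero]
    have hε2 : (ε : ZMod p) ^ 2 = 1 := by rcases hε with rfl | rfl <;> simp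
    have h2 : (y : ZMod p) ^ 2 = (2 ^ 2) ^ s * ((4 * z + 1 : ℤ) : ZMod p) ^ 2 := by
      rw [hY, Int.cast_mul, mul_pow, Int.cast_mul, mul_pow, hτ2, one_mul, Int.cast_pow,
        ← pow_mul, mul_comm s, pow_mul, Int.cast_ofNat]
    rw [← h2, hX]
    push_cast at h1 ⊢
    linear_combination h1 + (x : ZMod p) ^ 2 * hε2
  have hCD2 : 2 * ((4 * m + 1 : ℤ) : ZMod p) ^ 2 * ι = ((4 * (m + δ) + 1 : ℤ) : ZMod p) ^ 2 := by
    have h1 : ((4 * (m + δ) + 1 : ℤ) : ZMod p) =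
        ((4 * m + 1 : ℤ) : ZMod p) + ((4 * δ : ℤ) : ZMod p) := by
      push_cast; ring
    rw [h1, hd]
    linear_combination -((4 * m + 1 : ℤ) : ZMod p) ^ 2 * hfI
  have hT := congrArg (· ^ N) hCD2
  have hX3 := congrArg (· ^ N) hX2
  simp only [mul_pow, ← pow_mul] at hT hX3
  rw [hC, hCD, ← zpow_natCast ι N, hMn, mul_assoc, ← zpow_add₀ hf0] at hT
  -- The `N`-th power of `2c²ι = (c + d)²`, with the symbols of `c` and `c + d` inserted, determines
  -- `2^((p-1)/8)`.
  have hT' : (2 : ZMod p) ^ N = ι ^ (-(m + δ) - 2 * m - M) := by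
    apply mul_right_cancel₀ (zpow_ne_zero (2 * m + M) hf0)
    rw [hT, ← zpow_add₀ hf0]
    congr 1
    ring
  rw [heX, heY, show 2 * s * N = N * (2 * s) by ring, pow_mul 2 N, hT', ← zpow_natCast _ (2 * s), ← zpow_mul,
    mul_assoc, ← zpow_add₀ hf0, ← zpow_add₀ hf0] at hX3
  apply mul_right_cancel₀ (zpow_ne_zero _ hf0)
  rw [← hX3, ← zpow_add₀ hf0]
  congr 1
  push_cast
  ring

/-- The symbol `((a / b + i) / q)` for coprime integers `a` and `b`, when it does not vanish. -/
lemma symbol_eq_of_symbolAddI {a b q k : ℤ} (hab : IsCoprime a b) (hb : b ≠ 0) (hq : Odd q)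
    (h : symbolAddI ((a : ℚ) / b) ⟨q, 0⟩ = Complex.I ^ k) :
    symbol ⟨a, b⟩ q = Complex.I ^ k := by
  have hqc : (⟨q, 0⟩ : GaussianInt) = (q : GaussianInt) := rfl
  have hdc (n : ℤ) : (⟨n, 0⟩ : GaussianInt) = (n : GaussianInt) := rfl
  have ho := odd_norm_intCast hq
  rw [symbolAddI, hqc, hdc] at h
  set t : ℚ := (a : ℚ) / b
  have hden : symbol ((t.den : ℤ) : GaussianInt) (q : GaussianInt) = 1 := by
    by_cases hc : IsCoprime (t.den : ℤ) q
    · exact symbol_intCast_intCast hq hc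
    -- A denominator not coprime to `q` would make the quotient a division by zero, with value 0,
    -- which is no power of `I`.
    · rw [symbol_eq_zero (α := ((t.den : ℤ) : GaussianInt)) ho
        (fun hcc => hc (isCoprime_of_intCast hcc)), div_zero] at h
      exact absurd h.symm (zpow_ne_zero _ Complex.I_ne_zero)
  rw [hden, div_one] at h
  rw [← h]
  have hcop := Int.isCoprime_iff_nat_coprime.1 hab
  rcases lt_or_gt_of_ne hb with hneg | hpos
  -- The reduced fraction has positive denominator, so its numerator and denominator are `-a` and
  -- `-b`; the sign is harmless since `-1` has symbol 1 modulo `q`.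
  · have ht : t = ((-a : ℤ) : ℚ) / ((-b : ℤ) : ℚ) := by
      rw [Int.cast_neg, Int.cast_neg, neg_div_neg_eq]
    have hcop' : (-a).natAbs.Coprime (-b).natAbs := by rwa [Int.natAbs_neg, Int.natAbs_neg]
    have h1 : symbol (-1) (q : GaussianInt) = 1 := by
      have := symbol_intCast_intCast hq (n := -1) isCoprime_one_left.neg_left
      rwa [Int.cast_neg, Int.cast_one] at this
    rw [ht, Rat.num_div_eq_of_coprime (by omega) hcop', Rat.den_div_eq_of_coprime (by omega) hcop',
      show (⟨-a, -b⟩ : GaussianInt) = -1 * ⟨a, b⟩ by ext <;> simp, symbol_mul_left ho, h1, one_mul]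
  · rw [Rat.num_div_eq_of_coprime hpos hcop, Rat.den_div_eq_of_coprime hpos hcop]

lemma exists_eq_two_pow_mul {y : ℤ} (hy : y ≠ 0) :
    ∃ (τ z : ℤ) (s : ℕ), (τ = 1 ∨ τ = -1) ∧ y = τ * 2 ^ s * (4 * z + 1) := by
  have hfin : FiniteMultiplicity 2 y := Int.finiteMultiplicity_iff.2 ⟨by decide, hy⟩
  obtain ⟨u, hu, h2⟩ := hfin.exists_eq_pow_mul_and_not_dvd
  rcases (by omega : u % 4 = 1 ∨ u % 4 = 3) with h | h
  · exact ⟨1, u / 4, _, .inl rfl, by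
      rw [show 4 * (u / 4) + 1 = u by omega, one_mul]; exact hu⟩
  · exact ⟨-1, -u / 4, _, .inr rfl, by
      rw [show 4 * (-u / 4) + 1 = -u by omega, mul_neg, neg_mul, neg_mul, one_mul, neg_neg]
      exact hu⟩

lemma neg_one_zpow_mul_zpow {K : Type*} [Field K] {ι : K} (h : ι ^ 2 = -1) {a b e : ℤ}
    (he : e ≡ 2 * a + b [ZMOD 4]) : ι ^ e = (-1) ^ a * ι ^ b := by
  have h0 : ι ≠ 0 := by
    rintro rfl
    norm_num at h
  obtain ⟨r, hr⟩ := he.dvd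
  rw [← h, ← zpow_ofNat, ← zpow_mul, ← zpow_add₀ h0,
    show 2 * a + b = e + 4 * r by omega, zpow_add₀ h0, zpow_mul,
    show ι ^ (4 : ℤ) = 1 by rw [zpow_ofNat]; linear_combination (ι ^ 2 - 1) * h, one_zpow, mul_one]

end QuarticJacobi

/-! ### The theorem: parities and comparison of exponents -/

open QuarticJacobi

theorem theorem4p1 (p : ℕ) [Fact p.Prime] (hp : p % 8 = 1)
    (q : ℤ) (hq : Odd q) (hpq : ¬ (p : ℤ) ∣ q)
    (c d x y : ℤ) (hcd : (p : ℤ) = c ^ 2 + d ^ 2) (hxy : (p : ℤ) = x ^ 2 + 2 * q * y ^ 2)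
    (hc : c ≡ 1 [ZMOD 4])
    (r : ℕ) (d₀ : ℤ) (hd : d = 2 ^ r * d₀) (hd₀ : d₀ ≡ 1 [ZMOD 4])
    (hgcd : Int.gcd c (x + d) = 1)
    (k : ℤ)
    (hk : QuarticJacobi.symbolAddI ((c : ℚ) / ((x : ℚ) + (d : ℚ))) ⟨q, 0⟩ = Complex.I ^ k) :
    (q ≡ 1 [ZMOD 8] →
      ((-q : ℤ) : ZMod p) ^ ((p - 1) / 8) =
        (-1) ^ ((q - 1) / 8 + d / 4 + y / 2) * ((d : ZMod p) / (c : ZMod p)) ^ k) ∧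
    (q ≡ 3 [ZMOD 8] →
      ((-q : ℤ) : ZMod p) ^ ((p - 1) / 8) =
        (-1) ^ ((q - 3) / 8 + (x - 1) / 2) * ((d : ZMod p) / (c : ZMod p)) ^ (k + 1)) ∧
    (q ≡ 5 [ZMOD 8] →
      ((-q : ℤ) : ZMod p) ^ ((p - 1) / 8) =
        (-1) ^ ((q - 5) / 8 + d / 4 + (x - 1) / 2 + y / 2) *
          ((d : ZMod p) / (c : ZMod p)) ^ (k - 1)) ∧
    (q ≡ 7 [ZMOD 8] →
      ((-q : ℤ) : ZMod p) ^ ((p - 1) / 8) =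
        (-1) ^ ((q + 1) / 8) * ((d : ZMod p) / (c : ZMod p)) ^ k) := by
  clear hd hd₀ r d₀
  have hprime : p.Prime := Fact.out
  have hpi := Nat.prime_iff_prime_int.1 hprime
  obtain ⟨M, hM⟩ : ∃ M : ℤ, (p : ℤ) = 8 * M + 1 := ⟨p / 8, by omega⟩
  obtain ⟨m, rfl⟩ : ∃ m, c = 4 * m + 1 := ⟨c / 4, by unfold Int.ModEq at hc; omega⟩
  obtain ⟨q₁, hq₁⟩ := hq
  -- the parities of `d`, `x` and `y`
  obtain ⟨δ, rfl⟩ : ∃ δ, d = 4 * δ := by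
    rcases Int.even_or_odd' d with ⟨a, rfl | rfl⟩
    · rcases Int.even_or_odd' a with ⟨b, rfl | rfl⟩
      · exact ⟨b, by ring⟩
      · ring_nf at hcd; omega
    · ring_nf at hcd; omega
  obtain ⟨ε, w, hε, hX⟩ : ∃ ε w : ℤ, (ε = 1 ∨ ε = -1) ∧ 4 * w + 1 = ε * x := by
    have : x % 2 = 1 := by
      rcases Int.even_or_odd' x with ⟨b, rfl | rfl⟩
      · have : (p : ℤ) = 2 * (2 * b ^ 2 + q * y ^ 2) := by rw [hxy]; ring
        omega
      · omega
    rcases (by omega : x % 4 = 1 ∨ x % 4 = 3) with h | h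
    · exact ⟨1, x / 4, .inl rfl, by omega⟩
    · exact ⟨-1, -x / 4, .inr rfl, by omega⟩
  have hxx : x ^ 2 = (4 * w + 1) ^ 2 := by rw [hX]; rcases hε with rfl | rfl <;> ring
  obtain ⟨η, rfl⟩ : ∃ η, y = 2 * η := by
    rcases Int.even_or_odd' y with ⟨b, rfl | rfl⟩
    · exact ⟨b, rfl⟩
    -- For odd `y` the right-hand side would be 3 modulo 4.
    · rw [hxx, hq₁] at hxy; ring_nf at hxy; omega
  -- coprimality
  have hgcd' : IsCoprime (4 * m + 1) (x + 4 * δ) := Int.isCoprime_iff_gcd_eq_one.2 hgcd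
  have hxy' : IsCoprime x (2 * η) := isCoprime_of_prime_eq hprime hxy
  have hpxy : ∀ {a}, (p : ℤ) ∣ a → ¬ IsCoprime a (2 * η) ∨ ¬ (p : ℤ) ∣ 2 * η := by
    intro a ha
    by_contra h
    push Not at h
    exact hpi.not_isUnit (h.1.isUnit_of_dvd' ha h.2)
  have hpx : ¬ (p : ℤ) ∣ x := by
    intro h
    have h1 : (p : ℤ) ∣ q * (2 * (2 * η) ^ 2) := by
      obtain ⟨a, ha⟩ := h
      exact ⟨1 - x * a, by linear_combination -hxy - x * ha⟩
    rcases hpi.dvd_or_dvd h1 with h2 | h2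
    · exact hpq h2
    rcases hpi.dvd_or_dvd h2 with h3 | h3
    · have := Int.le_of_dvd (by norm_num) h3
      have := hprime.two_le
      omega
    · rcases hpxy h with h4 | h4
      · exact h4 hxy'
      · exact h4 (hpi.dvd_of_dvd_pow h3)
  have hpy : ¬ (p : ℤ) ∣ 2 * η := by
    intro h
    obtain ⟨a, ha⟩ := h
    have : (p : ℤ) ∣ x ^ 2 := ⟨1 - 2 * q * (2 * η) * a, by linear_combination -hxy - 2 * q * (2 * η) * ha⟩
    exact hpx (hpi.dvd_of_dvd_pow this)
  have hη : 2 * η ≠ 0 := fun h => hpy (h ▸ dvd_zero _)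
  have hxd : x + 4 * δ ≠ 0 := by rcases hε with rfl | rfl <;> omega
  obtain ⟨τ, z, s, hτ, hY⟩ := exists_eq_two_pow_mul hη
  obtain ⟨σ, n, hσ, hQ⟩ : ∃ σ n : ℤ, (σ = 1 ∨ σ = -1) ∧ 4 * n + 1 = σ * q := by
    rcases (by omega : q % 4 = 1 ∨ q % 4 = 3) with h | h
    · exact ⟨1, q / 4, .inl rfl, by omega⟩
    · exact ⟨-1, -q / 4, .inr rfl, by omega⟩
  replace hk : symbol ⟨4 * m + 1, x + 4 * δ⟩ q = Complex.I ^ k :=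
    symbol_eq_of_symbolAddI hgcd' hxd ⟨q₁, hq₁⟩ (by rw [← hk]; push_cast; rfl)
  -- the factor of `c + (x + d)i` of odd norm
  obtain ⟨t, g, ht, hγ, hi⟩ : ∃ (t : ℕ) (g : GaussianInt), ((t : ℤ) = (1 - ε) / 2) ∧
      (⟨4 * m + 1, x + 4 * δ⟩ : GaussianInt) = ⟨1, 1⟩ * ⟨0, 1⟩ ^ t * g ∧ Even g.im := by
    -- The odd part of `γ` has even imaginary part directly if `x ≡ 1 (mod 4)`, and after removing
    -- one more factor `i` if `x ≡ 3 (mod 4)`.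
    rcases hε with rfl | rfl
    · refine ⟨0, ⟨2 * m + 2 * w + 2 * δ + 1, 2 * w + 2 * δ - 2 * m⟩, by norm_num, ?_,
        ⟨w + δ - m, by ring⟩⟩
      rw [pow_zero, mul_one]
      ext
      · simp; ring
      · simp; linarith
    · refine ⟨1, ⟨-2 * w + 2 * δ - 2 * m - 1, -(2 * m - 2 * w + 2 * δ)⟩, by norm_num, ?_,
        ⟨-(m - w + δ), by ring⟩⟩
      rw [pow_one, show (⟨1, 1⟩ : GaussianInt) * ⟨0, 1⟩ = ⟨-1, 1⟩ by decide]
      ext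
      · simp; ring
      · simp; linarith
  have hN : g.norm = x * (x + 4 * δ) + q * (2 * η) ^ 2 := by
    have h1 := congrArg Zsqrtd.norm hγ
    have h2 : ((⟨0, 1⟩ : GaussianInt) ^ t).norm = 1 :=
      isUnit_iff_norm.1 ((isUnit_iff_norm.2 (by decide)).pow t)
    rw [Zsqrtd.norm_mul, Zsqrtd.norm_mul, norm_mk, norm_mk, h2] at h1
    apply mul_left_cancel₀ (two_ne_zero (α := ℤ))
    linear_combination -h1 + hxy - hcd
  -- This is `(N(g) - 1)/4` written out with `x = ε(4w + 1)` and `y = 2η`.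
  obtain ⟨e, he⟩ : ∃ e : ℤ, e = 4 * w ^ 2 + 2 * w + (4 * w + 1) * ε * δ + q * η ^ 2 := ⟨_, rfl⟩
  have hε2 : ε * ε = 1 := by rcases hε with rfl | rfl <;> norm_num
  have hNe : g.norm = 4 * e + 1 := by
    rw [hN, he]
    linear_combination hxx - 4 * ε * δ * hX - 4 * x * δ * hε2
  have hg : Odd g.norm := ⟨2 * e, by rw [hNe]; ring⟩
  have hge : (symbolExponent g : ℤ) = e := by
    have h1 := four_mul_symbolExponent hg
    have h2 := GaussianInt.abs_natCast_norm g
    have h3 := norm_mod_four hg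
    omega
  obtain ⟨eX, eY, heX, heY, hE⟩ := exponent_relation hprime hp hcd hxy hε hτ hσ hX
    (v := w + ε * δ) (by linear_combination hX) hY hQ hgcd' hpx hpy hγ hg hi hN hk
  obtain ⟨hι, hpow⟩ := neg_pow_eq hM hcd hxy hε hτ hX hY rfl heX heY
  -- comparing the exponents modulo `4`
  obtain ⟨m₁, hm₁⟩ := Int.even_mul_succ_self m
  obtain ⟨w₁, hw₁⟩ := Int.even_mul_succ_self w
  obtain ⟨η₁, hη₁⟩ := Int.even_mul_succ_self η
  obtain ⟨δ₁, hδ₁⟩ := Int.even_mul_succ_self δ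
  -- The two representations of `p` give two expressions for `M = (p - 1)/8`. Products `u(u + 1)`
  -- are even, so every square becomes linear modulo 4.
  have hMm : M = 4 * m₁ - m + 4 * δ₁ - 2 * δ := by
    have : 8 * M + 1 = (4 * m + 1) ^ 2 + (4 * δ) ^ 2 := by rw [← hM, hcd]
    linarith [this, hm₁, hδ₁]
  have hqη : q * η ^ 2 = 2 * (q₁ * η ^ 2 + η₁) - η := by rw [hq₁]; linear_combination hη₁
  have hMw : M = 4 * w₁ - w + q * η ^ 2 := by
    have : 8 * M + 1 = (4 * w + 1) ^ 2 + 2 * q * (2 * η) ^ 2 := by rw [← hM, hxy, hxx]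
    linarith [this, hw₁]
  -- The exponent `s` of 2 in `y` matters only through the parity of `s(e + δ + 3m + M)`. The
  -- bracket has the parity of `η`; either `s = 1`, or `η` is even and so is the product. Thus `s`
  -- disappears and `y/2 = η` takes its place.
  have hη' : s = 1 ∨ (Even η ∧ s ≠ 0) := by
    rcases s with _ | _ | s
    · rw [pow_zero] at hY
      rcases hτ with rfl | rfl <;> omega
    · exact .inl rfl
    · refine .inr ⟨⟨τ * 2 ^ s * (4 * z + 1), ?_⟩, by omega⟩
      apply mul_left_cancel₀ (two_ne_zero (α := ℤ))
      rw [hY]; ring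
  have heη : ∃ a, e + δ + 3 * m + M = η + 2 * a := by
    rw [he, hMm, hqη]
    rcases hε with rfl | rfl
    · exact ⟨2 * w ^ 2 + w + 2 * w * δ + (q₁ * η ^ 2 + η₁) - η + m + 2 * m₁ + 2 * δ₁, by ring⟩
    · exact ⟨2 * w ^ 2 + w - 2 * w * δ - δ + (q₁ * η ^ 2 + η₁) - η + m + 2 * m₁ + 2 * δ₁, by ring⟩
  have hs : ∃ a, s * (e + δ + 3 * m + M) = η + 2 * a := by
    obtain ⟨a, ha⟩ := heη
    rw [ha]
    rcases hη' with rfl | ⟨⟨b, rfl⟩, -⟩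
    · exact ⟨a, by push_cast; ring⟩
    · exact ⟨s * (b + a) - b, by ring⟩
  obtain ⟨a, ha⟩ := hs
  rw [hge] at hE
  obtain ⟨J, hJ⟩ := hE.dvd
  have hF : eX - eY + 2 * m + M + (m + δ) + s * (2 * (m + δ) + 4 * m + 2 * M) =
      k - n - 2 * n * t - (1 - σ) * e + 4 * J - 2 * e + w + 2 * w * t + (w + ε * δ)
        + 2 * (w + ε * δ) * t + 3 * m + M + δ + 2 * (η + 2 * a) := by
    linear_combination hJ + 2 * ha
  rw [hF] at hpow
  have heq : ∃ b, e = 2 * b + ε * δ + q * η ^ 2 := ⟨2 * w ^ 2 + w + 2 * w * ε * δ, by rw [he]; ring⟩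
  obtain ⟨b, hb⟩ := heq
  clear hpx hpy hN hNe hg hk hγ hi hge heX heY hE hY hτ hcd hxy hF ha hJ hη' heη he hxx hpxy hm₁ hw₁ hη₁ hδ₁
  -- The remaining nonlinear terms become atoms; once the signs `ε`, `σ` and the exponent `t` are
  -- fixed, the claim is linear modulo 4.
  generalize q * η ^ 2 = Q at *
  generalize q₁ * η ^ 2 = Q₁ at *
  rw [hpow]
  have main : ∀ A B, k - n - 2 * n * t - (1 - σ) * e + 4 * J - 2 * e + w + 2 * w * t + (w + ε * δ)
        + 2 * (w + ε * δ) * t + 3 * m + M + δ + 2 * (η + 2 * a) ≡ 2 * A + B [ZMOD 4] →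
      (((4 * δ : ℤ) : ZMod p) / ((4 * m + 1 : ℤ) : ZMod p)) ^
        (k - n - 2 * n * t - (1 - σ) * e + 4 * J - 2 * e + w + 2 * w * t + (w + ε * δ)
        + 2 * (w + ε * δ) * t + 3 * m + M + δ + 2 * (η + 2 * a)) =
      (-1) ^ A * (((4 * δ : ℤ) : ZMod p) / ((4 * m + 1 : ℤ) : ZMod p)) ^ B :=
    fun A B h => neg_one_zpow_mul_zpow hι h
  refine ⟨fun h8 => main _ _ ?_, fun h8 => main _ _ ?_, fun h8 => main _ _ ?_,
    fun h8 => main _ _ ?_⟩ <;>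
  · clear main hpow hι
    unfold Int.ModEq at h8 ⊢
    rcases hε with rfl | rfl <;> rcases hσ with rfl | rfl <;> norm_num at ht <;> rw [ht] <;> omega
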